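/- Let $(M,g)$ be a smooth pseudo-Riemannian manifold of dimension $n\ge 2$ and Lorentzian signature $(n-1,1)$, with Levi-Civita connection $\nabla$, and let $V$ be a smooth (immersed) lightlike hypersurface of $M$, i.e. $\dim V=n-1$ and $g$ is degenerate on every tangent hyperplane $T_xV$. An isotropic frame on an open set $U\subset V$ consists of smooth fields $e_1,e_a\in TV$ $(a=2,\dots,n-1)$ and $e_n\in TM|_V$ with $(e_1,e_1)=(e_1,e_a)=(e_n,e_n)=(e_a,e_n)=0$, $(e_1,e_n)=-1$ and $g_{ab}=(e_a,e_b)$ positive definite. Let $\omega^1,\omega^a$ be the coframe on $V$ dual to $e_1,e_a$, let $\omega_i^j$ be the connection forms, $\nabla e_i=\omega_i^j e_j$, and let $\lambda_{ab}$ be the second fundamental tensor, $\omega_a^n=\lambda_{ab}\,\omega^b$. Suppose that $V$ is totally umbilical: near each point there are an isotropic frame and a nowhere vanishing function $\lambda$ with $\lambda_{ab}=\lambda g_{ab}$. For a frame and a function $\lambda$ with $\lambda_{ab}=\lambda g_{ab}$, let $\mu$ be the coefficient of $\omega^1$ in $$d\lambda-\lambda\,\omega_1^1+\lambda^2\omega^1=\mu\,\omega^1+\mu_a\,\omega^a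 .$$ The components of the curvature tensor are defined by the structure equations $d\omega_j^i=\omega_j^k\wedge\omega_k^i+R^i_{jkl}\,\omega^k\wedge\omega^l$ on $M$ (summed over all $k,l$, with $R^i_{jkl}=-R^i_{jlk}$), and $R_{ijkl}=g_{im}R^m_{jkl}$. For a $2$-plane $\sigma\subset T_xV$ and an isotropic vector $N\ne 0$ in $\sigma$, the isotropic sectional curvature is $$K_N(\sigma)=\frac{R_{ijkl}N^iP^jP^kN^l}{(P,P)},$$ where $P\in\sigma$ is any nonisotropic vector. Then $K_N(\sigma)$ is well defined (nonisotropic vectors $P\in\sigma$ exist, and the quotient is the same for all of them), and for each point $x\in V$ and each isotropic vector $N\ne0$ in $T_xV$ it is the same for all $2$-planes $\sigma\subset T_xV$ containing $N$. Moreover, in every isotropic frame on an open set $U\subset V$, with any function $\lambda$ such that $\lambda_{ab}=\lambda g_{ab}$ on $U$, $$K_{e_1}(\sigma)=\tfrac12\,\mu(x)$$ for every $x\in U$ and every $2$-plane $\sigma\subset T_xV$ containing $e_1(x)$. -/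

import Mathlib

open scoped Manifold ContDiff Bundle

noncomputable section

namespace Lightlike

/-- The model space of `n`-dimensional manifolds. -/
abbrev Model (n : ℕ) : Type := EuclideanSpace ℝ (Fin n)

/-- A smooth pseudo-Riemannian metric of Lorentzian signature `(n - 1, 1)` on an `n`-dimensional
smooth manifold `M`, where `n = m + 2`. -/
structure LorentzMetric (m : ℕ) (M : Type*) [TopologicalSpace M]
    [ChartedSpace (Model (m + 2)) M] [IsManifold (𝓡 (m + 2)) ∞ M] where
  /-- the scalar product on the tangent space at `x` -/
  val (x : M) :
    TangentSpace (𝓡 (m + 2)) x →L[ℝ] TangentSpace (𝓡 (m + 2)) x →L[ℝ] ℝ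
  symm (x : M) (v w : TangentSpace (𝓡 (m + 2)) x) : val x v w = val x w v
  /-- at every point there is a pseudo-orthonormal basis with exactly one timelike vector -/
  signature (x : M) :
    ∃ b : Module.Basis (Fin (m + 2)) ℝ (TangentSpace (𝓡 (m + 2)) x),
      ∀ i j, val x (b i) (b j) = if i = j then (if i = Fin.last (m + 1) then -1 else 1) else 0
  contMDiff : ContMDiff (𝓡 (m + 2))
    ((𝓡 (m + 2)).prod 𝓘(ℝ, Model (m + 2) →L[ℝ] Model (m + 2) →L[ℝ] ℝ)) ∞
    (fun x : M ↦ Bundle.TotalSpace.mk' (Model (m + 2) →L[ℝ] Model (m + 2) →L[ℝ] ℝ)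
      (E := fun x : M ↦ TangentSpace (𝓡 (m + 2)) x →L[ℝ] TangentSpace (𝓡 (m + 2)) x →L[ℝ] ℝ)
      x (val x))

section Curvature

variable {m : ℕ} {M : Type*} [TopologicalSpace M]
  [ChartedSpace (Model (m + 2)) M] [IsManifold (𝓡 (m + 2)) ∞ M]

/-- The components of the metric in the preferred chart around `x₀`, at the point with coordinates
`y`: the bilinear form `(u, v) ↦ g_{ij}(y) uⁱ vʲ`. -/
def metricCoord (g : LorentzMetric m M) (x₀ : M) (y : Model (m + 2)) :
    Model (m + 2) →L[ℝ] Model (m + 2) →L[ℝ] ℝ :=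
  let z : M := (extChartAt (𝓡 (m + 2)) x₀).symm y
  let L : Model (m + 2) →L[ℝ] TangentSpace (𝓡 (m + 2)) z :=
    (trivializationAt (Model (m + 2)) (TangentSpace (𝓡 (m + 2)) : M → Type) x₀).symmL ℝ z
  (ContinuousLinearMap.precomp ℝ L).comp ((g.val z).comp L)

/-- The Christoffel symbols of the first kind in the preferred chart around `x₀`:
the linear form `z ↦ ½ (∂ᵤ g(v, z) + ∂ᵥ g(u, z) - ∂_z g(u, v))`. -/
def christoffelLow (g : LorentzMetric m M) (x₀ : M) (y u v : Model (m + 2)) :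
    Model (m + 2) →L[ℝ] ℝ :=
  let D := fderiv ℝ (metricCoord g x₀) y
  (1 / 2 : ℝ) • (D u v + D v u - (D.flip u).flip v)

/-- The Christoffel symbols of the second kind, `Γ(u, v)ᵏ = Γᵏᵢⱼ uⁱ vʲ`, of the Levi-Civita
connection in the preferred chart around `x₀`, at the point with coordinates `y`. -/
def christoffel (g : LorentzMetric m M) (x₀ : M) (y u v : Model (m + 2)) : Model (m + 2) :=
  (metricCoord g x₀ y).inverse (christoffelLow g x₀ y u v)

/-- The curvature operator `R(u, v) w = ∇ᵤ ∇ᵥ w - ∇ᵥ ∇ᵤ w - ∇_{[u, v]} w` of the Levi-Civita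
connection at `x`, computed in the preferred chart around `x`. (The tangent space at `x` is
identified with the model space by that very chart.) -/
def curvatureOp (g : LorentzMetric m M) (x : M) (u v w : TangentSpace (𝓡 (m + 2)) x) :
    TangentSpace (𝓡 (m + 2)) x :=
  let y : Model (m + 2) := extChartAt (𝓡 (m + 2)) x x
  let Γ : Model (m + 2) → Model (m + 2) → Model (m + 2) → Model (m + 2) := christoffel g x
  (fderiv ℝ (fun y' ↦ Γ y' v w) y u - fderiv ℝ (fun y' ↦ Γ y' u w) y v
    + Γ y u (Γ y v w) - Γ y v (Γ y u w) : Model (m + 2))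

/-- The curvature tensor `R_{ijkl} aⁱ bʲ uᵏ vˡ`, where `R_{ijkl} = g_{is} Rˢ_{jkl}` and the
components are the coefficients in the structure equations
`dωⁱⱼ = ωᵏⱼ ∧ ωⁱₖ + Rⁱⱼₖₗ ωᵏ ∧ ωˡ`, with summation over all pairs `k, l`. Since the curvature
form `dωⁱⱼ + ωⁱₖ ∧ ωᵏⱼ` takes the value `ωⁱ(R(u, v) eⱼ)` on `(u, v)`, while
`(ωᵏ ∧ ωˡ)(u, v) = uᵏ vˡ - uˡ vᵏ`, this is `½ g(a, R(u, v) b)`. -/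
def curvatureTensor (g : LorentzMetric m M) (x : M) (a b u v : TangentSpace (𝓡 (m + 2)) x) : ℝ :=
  (1 / 2 : ℝ) * g.val x a (curvatureOp g x u v b)

/-- `k` is the isotropic sectional curvature `K_N(σ)` of the plane `σ` with respect to the
isotropic vector `N ∈ σ`: for every nonisotropic vector `P ∈ σ` (and there are such vectors)
`k = (R(P, N) N, P) / (P, P)`, where `(R(P, N) N, P) = R_{ijkl} Nⁱ Pʲ Pᵏ Nˡ`. -/
def IsIsotropicSectionalCurvature (g : LorentzMetric m M) (x : M)
    (N : TangentSpace (𝓡 (m + 2)) x) (σ : Submodule ℝ (TangentSpace (𝓡 (m + 2)) x))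
    (k : ℝ) : Prop :=
  (∃ P ∈ σ, g.val x P P ≠ 0) ∧
    ∀ P ∈ σ, g.val x P P ≠ 0 → k = curvatureTensor g x N P P N / g.val x P P

end Curvature

section Hypersurface

variable {m : ℕ} {M : Type*} [TopologicalSpace M]
  [ChartedSpace (Model (m + 2)) M] [IsManifold (𝓡 (m + 2)) ∞ M]
  {V : Type*} [TopologicalSpace V]
  [ChartedSpace (Model (m + 1)) V] [IsManifold (𝓡 (m + 1)) ∞ V]

/-- The differential of `f : V → M` at `p`. -/
abbrev dmap (f : V → M) (p : V) :
    TangentSpace (𝓡 (m + 1)) p →L[ℝ] TangentSpace (𝓡 (m + 2)) (f p) :=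
  mfderiv (𝓡 (m + 1)) (𝓡 (m + 2)) f p

/-- The tangent hyperplane of the hypersurface `f : V → M` at `p`, as a subspace of the tangent
space of `M`. -/
def tangentHyperplane (f : V → M) (p : V) : Submodule ℝ (TangentSpace (𝓡 (m + 2)) (f p)) :=
  LinearMap.range (dmap f p).toLinearMap

/-- `f : V → M` is a (smoothly immersed) lightlike hypersurface: each tangent hyperplane is
isotropic, i.e. the induced quadratic form on it is degenerate. -/
structure IsLightlikeHypersurface (g : LorentzMetric m M) (f : V → M) : Prop where
  contMDiff : ContMDiff (𝓡 (m + 1)) (𝓡 (m + 2)) ∞ f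
  injective (p : V) : Function.Injective (dmap (m := m) f p)
  degenerate (p : V) : ∃ v ∈ tangentHyperplane (m := m) f p, v ≠ 0 ∧
    ∀ w ∈ tangentHyperplane (m := m) f p, g.val (f p) v w = 0

/-- The covariant derivative `∇_X Y` at `p` of a vector field `Y` of `M` along `f : V → M` in the
direction of `X ∈ T_p V`, for the Levi-Civita connection of `g`: in the preferred chart of `M`
around `f p` it is `∂_X Y + Γ(df X, Y)`. -/
def covDeriv (g : LorentzMetric m M) (f : V → M)
    (Y : (q : V) → TangentSpace (𝓡 (m + 2)) (f q)) (p : V) (X : TangentSpace (𝓡 (m + 1)) p) :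
    TangentSpace (𝓡 (m + 2)) (f p) :=
  let Ycoord : V → Model (m + 2) := fun q ↦
    (trivializationAt (Model (m + 2)) (TangentSpace (𝓡 (m + 2)) : M → Type) (f p)
      (⟨f q, Y q⟩ : TangentBundle (𝓡 (m + 2)) M)).2
  (mvfderiv (𝓡 (m + 1)) Ycoord p X
    + christoffel g (f p) (extChartAt (𝓡 (m + 2)) (f p) (f p)) (dmap f p X) (Y p) : Model (m + 2))

/-- A smooth isotropic frame field `e₁, e_a, eₙ` along the hypersurface `f : V → M` over the set
`U ⊆ V`: `e₁` (isotropic) and `e_a` (`a : Fin m`, spanning spacelike directions) are tangent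
to `V`, and `eₙ` is an isotropic transversal field; the matrix of scalar products is
`(0, 0, -1; 0, g_{ab}, 0; -1, 0, 0)` with `(g_{ab})` positive definite. -/
structure IsotropicFrame (g : LorentzMetric m M) (f : V → M) (U : Set V) where
  /-- the isotropic tangent field `e₁` -/
  e₁ : (p : V) → TangentSpace (𝓡 (m + 1)) p
  /-- the spacelike tangent fields `e_a` -/
  e : Fin m → (p : V) → TangentSpace (𝓡 (m + 1)) p
  /-- the isotropic transversal field `eₙ` along `f` -/
  en : (p : V) → TangentSpace (𝓡 (m + 2)) (f p)
  smooth_e₁ : ContMDiffOn (𝓡 (m + 1)) (𝓡 (m + 1)).tangent ∞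
    (fun p ↦ (⟨p, e₁ p⟩ : TangentBundle (𝓡 (m + 1)) V)) U
  smooth_e (a : Fin m) : ContMDiffOn (𝓡 (m + 1)) (𝓡 (m + 1)).tangent ∞
    (fun p ↦ (⟨p, e a p⟩ : TangentBundle (𝓡 (m + 1)) V)) U
  smooth_en : ContMDiffOn (𝓡 (m + 1)) (𝓡 (m + 2)).tangent ∞
    (fun p ↦ (⟨f p, en p⟩ : TangentBundle (𝓡 (m + 2)) M)) U
  g_e₁_e₁ : ∀ p ∈ U, g.val (f p) (dmap f p (e₁ p)) (dmap f p (e₁ p)) = 0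
  g_e₁_e : ∀ p ∈ U, ∀ a, g.val (f p) (dmap f p (e₁ p)) (dmap f p (e a p)) = 0
  g_e_pos : ∀ p ∈ U, ∀ ξ : Fin m → ℝ, ξ ≠ 0 →
    0 < ∑ a, ∑ b, g.val (f p) (dmap f p (e a p)) (dmap f p (e b p)) * ξ a * ξ b
  g_e₁_en : ∀ p ∈ U, g.val (f p) (dmap f p (e₁ p)) (en p) = -1
  g_e_en : ∀ p ∈ U, ∀ a, g.val (f p) (dmap f p (e a p)) (en p) = 0
  g_en_en : ∀ p ∈ U, g.val (f p) (en p) (en p) = 0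

namespace IsotropicFrame

variable {g : LorentzMetric m M} {f : V → M} {U : Set V}

/-- The field `e₁` as a vector field of `M` along `f`. -/
def vec₁ (F : IsotropicFrame g f U) (p : V) : TangentSpace (𝓡 (m + 2)) (f p) :=
  dmap f p (F.e₁ p)

/-- The field `e_a` as a vector field of `M` along `f`. -/
def vec (F : IsotropicFrame g f U) (a : Fin m) (p : V) : TangentSpace (𝓡 (m + 2)) (f p) :=
  dmap f p (F.e a p)

/-- The component `g_{ab}` of the first fundamental form. -/
def metric (F : IsotropicFrame g f U) (a b : Fin m) (p : V) : ℝ :=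
  g.val (f p) (F.vec a p) (F.vec b p)

/-- The connection form `ω₁¹`, the `e₁`-component of `∇ e₁`. The `e₁`-component of a vector `v`
in an isotropic frame is `-(v, eₙ)`. -/
def omega₁₁ (F : IsotropicFrame g f U) (p : V) (X : TangentSpace (𝓡 (m + 1)) p) : ℝ :=
  -g.val (f p) (covDeriv g f F.vec₁ p X) (F.en p)

/-- The connection form `ω_aⁿ`, the `eₙ`-component of `∇ e_a`. The `eₙ`-component of a vector `v`
in an isotropic frame is `-(v, e₁)`. -/
def omegaN (F : IsotropicFrame g f U) (a : Fin m) (p : V) (X : TangentSpace (𝓡 (m + 1)) p) : ℝ :=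
  -g.val (f p) (covDeriv g f (F.vec a) p X) (F.vec₁ p)

/-- The second fundamental tensor `λ_{ab}`: the coefficient of `ωᵇ` in `ω_aⁿ`. -/
def secondFundamental (F : IsotropicFrame g f U) (a b : Fin m) (p : V) : ℝ :=
  F.omegaN a p (F.e b p)

/-- `λ_{ab} = λ g_{ab}` at all points of `U`. -/
def IsUmbilicFactor (F : IsotropicFrame g f U) (lam : V → ℝ) : Prop :=
  ∀ p ∈ U, ∀ a b, F.secondFundamental a b p = lam p * F.metric a b p

/-- The coefficient `μ` of `ω¹` in the form `dλ - λ ω₁¹ + λ² ω¹` on `V`, i.e. the value of this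
form on `e₁`. -/
def mu (F : IsotropicFrame g f U) (lam : V → ℝ) (p : V) : ℝ :=
  mvfderiv (𝓡 (m + 1)) lam p (F.e₁ p) - lam p * F.omega₁₁ p (F.e₁ p) + lam p ^ 2

end IsotropicFrame

/-- The hypersurface `f : V → M` is totally umbilical: around each point there is an isotropic
frame field in which `λ_{ab} = λ g_{ab}` with a nowhere vanishing function `λ`. -/
def IsTotallyUmbilical (g : LorentzMetric m M) (f : V → M) : Prop :=
  ∀ p : V, ∃ U : Set V, IsOpen U ∧ p ∈ U ∧ ∃ (F : IsotropicFrame g f U) (lam : V → ℝ),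
    F.IsUmbilicFactor lam ∧ ∀ q ∈ U, lam q ≠ 0

end Hypersurface

end Lightlike

end

/-! Write `K` for `e₁` as a field along `f` and `H(u,v)` for the covariant derivative along `u` of
the coordinate field `df(v)`. Since `K` is null and orthogonal to the hypersurface, `(K, H(u,v))` is
a symmetric bilinear form. Umbilicity is given on the `e_a` only, but differentiating `(K,K) = 0`
gives `(K, H(u,e₁)) = 0`, so `(K, H(u,v)) = -λ (df u, df v)` for all `u, v`
(`inner_hessianField_of_frame`). Differentiating `(K, df v) = 0` then gives `∇_u K = λ df(u) + γ(u)
K` with `γ = ω₁¹ - λ ω¹`.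

Differentiate the umbilicity relation once more and antisymmetrize in `u` and `e₁`. The left side
produces the curvature by the Ricci identity (`ricci_hessianField`), while on the right everything
cancels except `(dλ(e₁) - λ γ(e₁)) (df u, df w)` (`inner_curvature_of_umbilic`). The bracket is `μ`,
so `(K, R(P,K)P) = μ (P,P)`. The curvature components carry a factor `1/2`, hence `K_{e₁}(σ) = μ/2`,
independent of `σ`. An arbitrary isotropic tangent vector is `c e₁`, and the curvature scales by
`c²`.

The computation is done in one fixed pair of charts, whereas `covDeriv` at `q` uses the chart
preferred at `f q`. The transformation law of the Christoffel symbols (`Koszul.pullback`,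
`comp_covDeriv`) bridges the two. -/

open scoped Topology

namespace Lightlike

/-! ### Levi-Civita calculus along a map between normed spaces, and the curvature identity. -/

section Calculus

variable {X E : Type*} [NormedAddCommGroup X] [NormedSpace ℝ X]
  [NormedAddCommGroup E] [NormedSpace ℝ E]

/-- `Γ` satisfies the Koszul formula of the metric `G` (in coordinates) at the point `z`. -/
def Koszul (G : E → E →L[ℝ] E →L[ℝ] ℝ) (Γ : E →L[ℝ] E →L[ℝ] E) (z : E) : Prop :=
  ∀ u v w, G z (Γ u v) w =
    (1 / 2 : ℝ) * (fderiv ℝ G z u v w + fderiv ℝ G z v u w - fderiv ℝ G z w u v)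

variable {G : E → E →L[ℝ] E →L[ℝ] ℝ} {z : E}

theorem fderiv_metric_symm (hd : DifferentiableAt ℝ G z)
    (hs : ∀ᶠ z' in 𝓝 z, ∀ u v, G z' u v = G z' v u) (w u v : E) :
    fderiv ℝ G z w u v = fderiv ℝ G z w v u := by
  have h1 : ∀ a b, fderiv ℝ (fun z' ↦ G z' a b) z w = fderiv ℝ G z w a b := by
    intro a b
    have := ((hd.hasFDerivAt.clm_apply (hasFDerivAt_const a z)).clm_apply
      (hasFDerivAt_const b z)).fderiv
    rw [this]; simp
  rw [← h1, ← h1]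
  have : (fun z' ↦ G z' u v) =ᶠ[𝓝 z] fun z' ↦ G z' v u := hs.mono fun z' h ↦ h u v
  rw [this.fderiv_eq]

/-- Adding the Koszul formulas for `(w, a; b)` and `(w, b; a)` cancels all but two equal copies of
the derivative in the direction `w`. -/
theorem Koszul.compatible {Γ : E →L[ℝ] E →L[ℝ] E} (hk : Koszul G Γ z)
    (hd : DifferentiableAt ℝ G z) (hs : ∀ᶠ z' in 𝓝 z, ∀ u v, G z' u v = G z' v u) (w a b : E) :
    fderiv ℝ G z w a b = G z (Γ w a) b + G z a (Γ w b) := by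
  rw [hs.self_of_nhds a, hk, hk, fderiv_metric_symm hd hs w b a]
  have h1 := fderiv_metric_symm hd hs b w a
  have h2 := fderiv_metric_symm hd hs a w b
  linarith

theorem Koszul.symm {Γ : E →L[ℝ] E →L[ℝ] E} (hk : Koszul G Γ z)
    (hd : DifferentiableAt ℝ G z) (hs : ∀ᶠ z' in 𝓝 z, ∀ u v, G z' u v = G z' v u)
    (hn : ∀ a, (∀ b, G z a b = 0) → a = 0) (u v : E) : Γ u v = Γ v u := by
  rw [← sub_eq_zero]
  refine hn _ fun w ↦ ?_
  rw [map_sub, sub_apply, hk, hk, fderiv_metric_symm hd hs w u v]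
  ring

variable {F : X → E} {y : X}

theorem hasFDerivAt_comp_map {W : Type*} [NormedAddCommGroup W] [NormedSpace ℝ W] {B : E → W}
    (hB : DifferentiableAt ℝ B (F y)) (hF : DifferentiableAt ℝ F y) :
    HasFDerivAt (fun y' ↦ B (F y')) ((fderiv ℝ B (F y)).comp (fderiv ℝ F y)) y :=
  hB.hasFDerivAt.comp y hF.hasFDerivAt

-- Used with `Z = ℝ` for the metric and `Z = E` for the Christoffel symbols. The derivative is
-- existential because only its values matter.
set_option synthInstance.maxHeartbeats 400000 in
theorem exists_hasFDerivAt_bilin {Z : Type*} [NormedAddCommGroup Z] [NormedSpace ℝ Z]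
    {B : E → E →L[ℝ] E →L[ℝ] Z} (hB : DifferentiableAt ℝ B (F y)) (hF : DifferentiableAt ℝ F y)
    {A C : X → E} (hA : DifferentiableAt ℝ A y) (hC : DifferentiableAt ℝ C y) :
    ∃ S : X →L[ℝ] Z, HasFDerivAt (fun y' ↦ B (F y') (A y') (C y')) S y ∧
      ∀ u, S u = fderiv ℝ B (F y) (fderiv ℝ F y u) (A y) (C y)
        + B (F y) (fderiv ℝ A y u) (C y) + B (F y) (A y) (fderiv ℝ C y u) := by
  have h0 := hasFDerivAt_comp_map (W := E →L[ℝ] E →L[ℝ] Z) hB hF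
  refine ⟨_, (h0.clm_apply hA.hasFDerivAt).clm_apply hC.hasFDerivAt, fun u ↦ ?_⟩
  simp only [add_apply, ContinuousLinearMap.comp_apply,
    ContinuousLinearMap.flip_apply]
  abel

/-- Metric compatibility of the covariant derivative of fields along a map. -/
theorem Koszul.fderiv_inner {Γ : E →L[ℝ] E →L[ℝ] E} (hk : Koszul G Γ (F y))
    (hd : DifferentiableAt ℝ G (F y)) (hs : ∀ᶠ z' in 𝓝 (F y), ∀ u v, G z' u v = G z' v u)
    (hF : DifferentiableAt ℝ F y) {A B : X → E} (hA : DifferentiableAt ℝ A y)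
    (hB : DifferentiableAt ℝ B y) (u : X) :
    fderiv ℝ (fun y' ↦ G (F y') (A y') (B y')) y u =
      G (F y) (fderiv ℝ A y u + Γ (fderiv ℝ F y u) (A y)) (B y) +
      G (F y) (A y) (fderiv ℝ B y u + Γ (fderiv ℝ F y u) (B y)) := by
  obtain ⟨S, hS, hS'⟩ := exists_hasFDerivAt_bilin hd hF hA hB
  rw [hS.fderiv, hS', hk.compatible hd hs]
  simp only [map_add, add_apply]
  ring

noncomputable section

/-- The covariant derivative of the coordinate field `∂F/∂w` in the direction `v`. -/
def hessianField (Γ : E → E →L[ℝ] E →L[ℝ] E) (F : X → E) (y v w : X) : E :=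
  fderiv ℝ (fderiv ℝ F) y v w + Γ (F y) (fderiv ℝ F y v) (fderiv ℝ F y w)

/-- The curvature operator in coordinates. -/
def coordCurvature (Γ : E → E →L[ℝ] E →L[ℝ] E) (z u v w : E) : E :=
  fderiv ℝ Γ z u v w - fderiv ℝ Γ z v u w + Γ z u (Γ z v w) - Γ z v (Γ z u w)

end

variable {Γ : E → E →L[ℝ] E →L[ℝ] E}

theorem hasFDerivAt_fderiv_apply (h : DifferentiableAt ℝ (fderiv ℝ F) y) (a : X) :
    HasFDerivAt (fun y' ↦ fderiv ℝ F y' a) ((fderiv ℝ (fderiv ℝ F) y).flip a) y := by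
  simpa using h.hasFDerivAt.clm_apply (hasFDerivAt_const a y)

theorem hasFDerivAt_hessianField (hF : ContDiffAt ℝ 3 F y) (hΓ : DifferentiableAt ℝ Γ (F y))
    (v w : X) :
    ∃ S' : X →L[ℝ] E, HasFDerivAt (fun y' ↦ hessianField Γ F y' v w) S' y ∧
      ∀ u, S' u = fderiv ℝ (fderiv ℝ (fderiv ℝ F)) y u v w
        + fderiv ℝ Γ (F y) (fderiv ℝ F y u) (fderiv ℝ F y v) (fderiv ℝ F y w)
        + Γ (F y) (fderiv ℝ (fderiv ℝ F) y u v) (fderiv ℝ F y w)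
        + Γ (F y) (fderiv ℝ F y v) (fderiv ℝ (fderiv ℝ F) y u w) := by
  have hF1 : ContDiffAt ℝ 2 (fderiv ℝ F) y := hF.fderiv_right (by norm_num)
  have hF2 : ContDiffAt ℝ 1 (fderiv ℝ (fderiv ℝ F)) y := hF1.fderiv_right (by norm_num)
  have d0 := (hF.differentiableAt (by norm_num)).hasFDerivAt
  have d1 := (hF1.differentiableAt (by norm_num)).hasFDerivAt
  have d2 := (hF2.differentiableAt (by norm_num)).hasFDerivAt
  obtain ⟨S, hS, hS'⟩ := exists_hasFDerivAt_bilin hΓ d0.differentiableAt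
    (hasFDerivAt_fderiv_apply d1.differentiableAt v).differentiableAt
    (hasFDerivAt_fderiv_apply d1.differentiableAt w).differentiableAt
  refine ⟨_, ((d2.clm_apply (hasFDerivAt_const v y)).clm_apply (hasFDerivAt_const w y)).add hS,
    fun u ↦ ?_⟩
  simp only [add_apply, ContinuousLinearMap.comp_apply, ContinuousLinearMap.flip_apply, hS',
    zero_apply, map_zero, zero_add, (hasFDerivAt_fderiv_apply d1.differentiableAt _).fderiv]
  abel

/-- The Ricci identity for the coordinate fields of a map. -/
theorem ricci_hessianField (hF : ContDiffAt ℝ 3 F y) (hΓ : DifferentiableAt ℝ Γ (F y)) (u v w : X) :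
    (fderiv ℝ (fun y' ↦ hessianField Γ F y' v w) y u
        + Γ (F y) (fderiv ℝ F y u) (hessianField Γ F y v w))
      - (fderiv ℝ (fun y' ↦ hessianField Γ F y' u w) y v
        + Γ (F y) (fderiv ℝ F y v) (hessianField Γ F y u w)) =
      coordCurvature Γ (F y) (fderiv ℝ F y u) (fderiv ℝ F y v) (fderiv ℝ F y w) := by
  obtain ⟨S, hS, hS'⟩ := hasFDerivAt_hessianField hF hΓ v w
  obtain ⟨T, hT, hT'⟩ := hasFDerivAt_hessianField hF hΓ u w
  have hF1 : ContDiffAt ℝ 2 (fderiv ℝ F) y := hF.fderiv_right (by norm_num)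
  -- With `s2` and `s3`, all terms containing second or third derivatives of `F` cancel in the
  -- commutator; only the terms built from `Γ` and its derivative remain.
  have s2 : fderiv ℝ (fderiv ℝ F) y u v = fderiv ℝ (fderiv ℝ F) y v u :=
    (hF.isSymmSndFDerivAt (by simp; norm_num)) u v
  have s3 : fderiv ℝ (fderiv ℝ (fderiv ℝ F)) y u v = fderiv ℝ (fderiv ℝ (fderiv ℝ F)) y v u :=
    (hF1.isSymmSndFDerivAt (by simp)) u v
  rw [hS.fderiv, hT.fderiv, hS', hT', s2, s3]
  simp only [hessianField, coordCurvature, map_add]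
  abel

/-- The main identity: `G(K, R(u, v) w)` for a null field `K = dF(e)` orthogonal to the
hypersurface, whose second fundamental form is `lam` times the first one. -/
theorem inner_curvature_of_umbilic {K : X → E} {lam : X → ℝ} {γ : X → ℝ} (e u w : X)
    (hF : ContDiffAt ℝ 3 F y) (hΓ : DifferentiableAt ℝ Γ (F y))
    (hd : DifferentiableAt ℝ G (F y)) (hs : ∀ᶠ z' in 𝓝 (F y), ∀ a b, G z' a b = G z' b a)
    (hn : ∀ a, (∀ b, G (F y) a b = 0) → a = 0) (hk : Koszul G (Γ (F y)) (F y))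
    (hK : DifferentiableAt ℝ K y) (hlam : DifferentiableAt ℝ lam y)
    (hKe : K y = fderiv ℝ F y e)
    (horth : ∀ v, G (F y) (K y) (fderiv ℝ F y v) = 0)
    (humb : ∀ᶠ y' in 𝓝 y, ∀ a b, G (F y') (K y') (hessianField Γ F y' a b) =
      -lam y' * G (F y') (fderiv ℝ F y' a) (fderiv ℝ F y' b))
    (hdec : ∀ a W, G (F y) (fderiv ℝ K y a + Γ (F y) (fderiv ℝ F y a) (K y)) W =
      lam y * G (F y) (fderiv ℝ F y a) W + γ a * G (F y) (K y) W) :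
    G (F y) (K y) (coordCurvature Γ (F y) (fderiv ℝ F y u) (fderiv ℝ F y e) (fderiv ℝ F y w)) =
      (fderiv ℝ lam y e - lam y * γ e) * G (F y) (fderiv ℝ F y u) (fderiv ℝ F y w) := by
  have hF1 : ContDiffAt ℝ 2 (fderiv ℝ F) y := hF.fderiv_right (by norm_num)
  have d0 := (hF.differentiableAt (by norm_num))
  have d1 := (hF1.differentiableAt (by norm_num))
  have dF := hasFDerivAt_fderiv_apply d1
  have hΓs := hk.symm hd hs hn
  have s2 : ∀ a b, fderiv ℝ (fderiv ℝ F) y a b = fderiv ℝ (fderiv ℝ F) y b a := fun a b ↦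
    (hF.isSymmSndFDerivAt (by simp; norm_num)) a b
  have hHs : ∀ a b, hessianField Γ F y a b = hessianField Γ F y b a := fun a b ↦ by
    rw [hessianField, hessianField, s2, hΓs]
  have gs := hs.self_of_nhds
  -- derivative of the umbilicity relation
  have D : ∀ a b, G (F y) (K y) (fderiv ℝ (fun y' ↦ hessianField Γ F y' b w) y a
        + Γ (F y) (fderiv ℝ F y a) (hessianField Γ F y b w)) =
      -fderiv ℝ lam y a * G (F y) (fderiv ℝ F y b) (fderiv ℝ F y w)
      - lam y * (G (F y) (hessianField Γ F y a b) (fderiv ℝ F y w)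
        + G (F y) (fderiv ℝ F y b) (hessianField Γ F y a w))
      - lam y * G (F y) (fderiv ℝ F y a) (hessianField Γ F y b w)
      - γ a * G (F y) (K y) (hessianField Γ F y b w) := by
    intro a b
    obtain ⟨S, hS, -⟩ := hasFDerivAt_hessianField hF hΓ b w
    have e1 := hk.fderiv_inner hd hs d0 hK hS.differentiableAt a
    have e2 := hk.fderiv_inner hd hs d0 (dF b).differentiableAt (dF w).differentiableAt a
    have dh : DifferentiableAt ℝ
        (fun y' ↦ G (F y') (fderiv ℝ F y' b) (fderiv ℝ F y' w)) y :=
      (exists_hasFDerivAt_bilin hd d0 (dF b).differentiableAt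
        (dF w).differentiableAt).choose_spec.1.differentiableAt
    have e3 : (fun y' ↦ G (F y') (K y') (hessianField Γ F y' b w)) =ᶠ[𝓝 y]
        fun y' ↦ -lam y' * G (F y') (fderiv ℝ F y' b) (fderiv ℝ F y' w) :=
      humb.mono fun y' h ↦ h b w
    -- The left side is now expanded by metric compatibility and the right side by the product rule;
    -- `hdec` then replaces the derivative of `K`.
    rw [e3.fderiv_eq, (hlam.hasFDerivAt.fun_neg.fun_mul dh.hasFDerivAt).fderiv] at e1
    simp only [add_apply, smul_apply, e2,
      (dF b).fderiv, (dF w).fderiv, ContinuousLinearMap.flip_apply, hdec, smul_eq_mul,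
      neg_apply] at e1
    simp only [hessianField] at e1 ⊢
    linarith
  have ric := ricci_hessianField hF hΓ u e w
  have h0 : G (F y) (K y) (hessianField Γ F y u w) =
      -lam y * G (F y) (fderiv ℝ F y u) (fderiv ℝ F y w) := humb.self_of_nhds u w
  have h1 : G (F y) (K y) (hessianField Γ F y e w) = 0 := by
    rw [humb.self_of_nhds e w, ← hKe, horth]; simp
  -- In `D u e - D e u` the terms with `H(u,e)`, those with `(df u, H(e,w))` and the `λ²` terms
  -- cancel. The derivative of `lam` along `u` is multiplied by `(K, df w) = 0`.
  rw [← ric, map_sub, D u e, D e u, hHs e u, ← hKe, horth, h0, h1]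
  ring

end Calculus
-- The metric, Christoffel symbols and curvature in a chart.
section Metric

variable {m : ℕ} {M : Type*} [TopologicalSpace M]
  [ChartedSpace (Model (m + 2)) M] [IsManifold (𝓡 (m + 2)) ∞ M]

/-- The components of tangent vectors at `z` in the preferred chart around `x₀`. -/
noncomputable abbrev comp {n : ℕ} {N : Type*} [TopologicalSpace N] [ChartedSpace (Model n) N]
    [IsManifold (𝓡 n) ∞ N] (x₀ z : N) : TangentSpace (𝓡 n) z →L[ℝ] Model n :=
  (trivializationAt (Model n) (TangentSpace (𝓡 n) : N → Type) x₀).continuousLinearMapAt ℝ z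

/-- The tangent vector at `z` with given components in the preferred chart around `x₀`. -/
noncomputable abbrev uncomp {n : ℕ} {N : Type*} [TopologicalSpace N] [ChartedSpace (Model n) N]
    [IsManifold (𝓡 n) ∞ N] (x₀ z : N) : Model n →L[ℝ] TangentSpace (𝓡 n) z :=
  (trivializationAt (Model n) (TangentSpace (𝓡 n) : N → Type) x₀).symmL ℝ z

section General

variable {n : ℕ} {N : Type*} [TopologicalSpace N] [ChartedSpace (Model n) N]
    [IsManifold (𝓡 n) ∞ N] {x₀ z : N}

theorem uncomp_comp (hz : z ∈ (chartAt (Model n) x₀).source) (v : TangentSpace (𝓡 n) z) :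
    uncomp x₀ z (comp x₀ z v) = v :=
  Bundle.Trivialization.symmL_continuousLinearMapAt _ (by simpa using hz) v

theorem comp_uncomp (hz : z ∈ (chartAt (Model n) x₀).source) (v : Model n) :
    comp x₀ z (uncomp x₀ z v) = v :=
  Bundle.Trivialization.continuousLinearMapAt_symmL _ (by simpa using hz) v

theorem comp_self (v : TangentSpace (𝓡 n) x₀) : comp x₀ x₀ v = v := by
  rw [comp, TangentBundle.continuousLinearMapAt_trivializationAt (mem_chart_source _ _),
    mfderiv_extChartAt_self]
  rfl

theorem trivializationAt_apply_snd (hz : z ∈ (chartAt (Model n) x₀).source)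
    (v : TangentSpace (𝓡 n) z) :
    (trivializationAt (Model n) (TangentSpace (𝓡 n) : N → Type) x₀
      (⟨z, v⟩ : TangentBundle (𝓡 n) N)).2 = comp x₀ z v :=
  (Bundle.Trivialization.continuousLinearMapAt_apply_of_mem (R := ℝ) _
    (by simpa using hz) v).symm

end General

theorem inner_eq_metricCoord (g : LorentzMetric m M) {x₀ z : M}
    (hz : z ∈ (chartAt (Model (m + 2)) x₀).source) (v w : TangentSpace (𝓡 (m + 2)) z) :
    g.val z v w =
      metricCoord g x₀ (extChartAt (𝓡 (m + 2)) x₀ z) (comp x₀ z v) (comp x₀ z w) := by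
  -- `metricCoord` evaluates the metric at the chart's inverse image of the coordinates of `z`,
  -- which equals `z` only propositionally; a free `z'` lets the dependent types be identified.
  have h : ∀ z', z' = z → g.val z v w =
      g.val z' (uncomp x₀ z' (comp x₀ z v)) (uncomp x₀ z' (comp x₀ z w)) := by
    rintro _ rfl
    rw [uncomp_comp hz, uncomp_comp hz]
  exact h _ ((extChartAt (𝓡 (m + 2)) x₀).left_inv (by simpa using hz))

theorem metricCoord_apply (g : LorentzMetric m M) (x₀ : M) (y u v : Model (m + 2)) :
    metricCoord g x₀ y u v =
      g.val ((extChartAt (𝓡 (m + 2)) x₀).symm y)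
        (uncomp x₀ _ u) (uncomp x₀ _ v) := rfl

theorem metricCoord_symm (g : LorentzMetric m M) (x₀ : M) (y u v : Model (m + 2)) :
    metricCoord g x₀ y u v = metricCoord g x₀ y v u := by
  rw [metricCoord_apply, metricCoord_apply, g.symm]

theorem LorentzMetric.nondegenerate (g : LorentzMetric m M) (x : M)
    (v : TangentSpace (𝓡 (m + 2)) x) (h : ∀ w, g.val x v w = 0) : v = 0 := by
  obtain ⟨b, hb⟩ := g.signature x
  refine b.ext_elem fun i ↦ ?_
  have h1 := h (b i)
  rw [← b.sum_repr v] at h1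
  simp only [map_sum, map_smul, sum_apply, smul_apply, hb,
    smul_eq_mul, Finset.sum_ite_eq', Finset.mem_univ, if_true, mul_ite, mul_zero] at h1
  split_ifs at h1 <;> simpa using h1

theorem metricCoord_nondegenerate (g : LorentzMetric m M) {x₀ : M} {y : Model (m + 2)}
    (hy : y ∈ (extChartAt (𝓡 (m + 2)) x₀).target) (u : Model (m + 2))
    (h : ∀ v, metricCoord g x₀ y u v = 0) : u = 0 := by
  have hz : (extChartAt (𝓡 (m + 2)) x₀).symm y ∈ (chartAt (Model (m + 2)) x₀).source := by
    simpa using (extChartAt (𝓡 (m + 2)) x₀).map_target hy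
  have : uncomp x₀ _ u = 0 := g.nondegenerate _ _ fun w ↦ by
    have := h (comp x₀ _ w)
    rwa [metricCoord_apply, uncomp_comp hz] at this
  rw [← comp_uncomp hz u, this, map_zero]

/-- It is enough to test on fixed `u, v`. The fields with these constant components are smooth local
sections, and the smooth metric is evaluated on them. -/
theorem contDiffOn_metricCoord (g : LorentzMetric m M) (x₀ : M) :
    ContDiffOn ℝ ∞ (metricCoord g x₀) (extChartAt (𝓡 (m + 2)) x₀).target := by
  refine contDiffOn_clm_apply.2 fun u ↦ contDiffOn_clm_apply.2 fun v ↦ ?_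
  rw [← contMDiffOn_iff_contDiffOn]
  intro y hy
  have hz : (extChartAt (𝓡 (m + 2)) x₀).symm y ∈ (chartAt (Model (m + 2)) x₀).source := by
    simpa using (extChartAt (𝓡 (m + 2)) x₀).map_target hy
  have hs := contMDiffOn_extChartAt_symm (I := 𝓡 (m + 2)) (n := ∞) x₀ y hy
  have hsec : ∀ u : Model (m + 2), ContMDiffWithinAt 𝓘(ℝ, Model (m + 2)) (𝓡 (m + 2)).tangent ∞
      (fun y' ↦ Bundle.TotalSpace.mk' (Model (m + 2))
        (E := (TangentSpace (𝓡 (m + 2)) : M → Type)) ((extChartAt (𝓡 (m + 2)) x₀).symm y')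
        (uncomp x₀ _ u)) (extChartAt (𝓡 (m + 2)) x₀).target y := by
    intro u
    have h1 : ContMDiffAt (𝓡 (m + 2)) (𝓡 (m + 2)).tangent ∞
        (fun z : M ↦ Bundle.TotalSpace.mk' (Model (m + 2))
          (E := (TangentSpace (𝓡 (m + 2)) : M → Type)) z (uncomp x₀ z u))
        ((extChartAt (𝓡 (m + 2)) x₀).symm y) := by
      rw [(trivializationAt (Model (m + 2))
        (TangentSpace (𝓡 (m + 2)) : M → Type) x₀).contMDiffAt_section_iff (by simpa using hz)]
      refine (contMDiffAt_const (c := u)).congr_of_eventuallyEq ?_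
      filter_upwards [(chartAt (Model (m + 2)) x₀).open_source.mem_nhds hz] with z hz'
      rw [trivializationAt_apply_snd hz', comp_uncomp hz']
    exact h1.comp_contMDiffWithinAt y hs
  have hg : ContMDiffWithinAt 𝓘(ℝ, Model (m + 2)) ((𝓡 (m + 2)).prod 𝓘(ℝ, ℝ)) ∞
      (fun y' ↦ Bundle.TotalSpace.mk' ℝ (E := Bundle.Trivial M ℝ)
        ((extChartAt (𝓡 (m + 2)) x₀).symm y')
        (metricCoord g x₀ y' u v))
      (extChartAt (𝓡 (m + 2)) x₀).target y := by
    refine ContMDiffWithinAt.clm_bundle_apply₂ (F₁ := Model (m + 2)) (F₂ := Model (m + 2))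
      ?_ (hsec u) (hsec v)
    exact ContMDiffAt.comp_contMDiffWithinAt y g.contMDiff.contMDiffAt hs
  rw [Bundle.contMDiffWithinAt_totalSpace] at hg
  exact hg.2

theorem contDiffAt_metricCoord (g : LorentzMetric m M) {x₀ : M} {y : Model (m + 2)}
    (hy : y ∈ (extChartAt (𝓡 (m + 2)) x₀).target) : ContDiffAt ℝ ∞ (metricCoord g x₀) y :=
  (contDiffOn_metricCoord g x₀).contDiffAt ((isOpen_extChartAt_target x₀).mem_nhds hy)

/-- `christoffel` is built on `ContinuousLinearMap.inverse`, which is meaningful only at invertible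
maps. Nondegeneracy gives injectivity, and the dual has the same dimension. -/
theorem isInvertible_metricCoord (g : LorentzMetric m M) {x₀ : M} {y : Model (m + 2)}
    (hy : y ∈ (extChartAt (𝓡 (m + 2)) x₀).target) : (metricCoord g x₀ y).IsInvertible := by
  have hi : Function.Injective (metricCoord g x₀ y).toLinearMap := by
    rw [injective_iff_map_eq_zero]
    intro u hu
    refine metricCoord_nondegenerate g hy u fun v ↦ ?_
    have : metricCoord g x₀ y u = 0 := hu
    rw [this]; rfl
  have hf : Module.finrank ℝ (Model (m + 2)) = Module.finrank ℝ (Model (m + 2) →L[ℝ] ℝ) := by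
    rw [← LinearMap.toContinuousLinearMap.finrank_eq]
    exact Subspace.dual_finrank_eq.symm
  refine ⟨(LinearEquiv.ofInjectiveOfFinrankEq _ hi hf).toContinuousLinearEquiv, ?_⟩
  ext u v
  rfl

theorem christoffelLow_apply (g : LorentzMetric m M) (x₀ : M) (y u v w : Model (m + 2)) :
    christoffelLow g x₀ y u v w = (1 / 2 : ℝ) * (fderiv ℝ (metricCoord g x₀) y u v w
      + fderiv ℝ (metricCoord g x₀) y v u w - fderiv ℝ (metricCoord g x₀) y w u v) := by
  simp [christoffelLow]

theorem contDiffOn_christoffelLow (g : LorentzMetric m M) (x₀ : M) (u v : Model (m + 2)) :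
    ContDiffOn ℝ ∞ (fun y ↦ christoffelLow g x₀ y u v) (extChartAt (𝓡 (m + 2)) x₀).target := by
  refine contDiffOn_clm_apply.2 fun w ↦ ?_
  have hD (a b c : Model (m + 2)) : ContDiffOn ℝ ∞ (fun y ↦ fderiv ℝ (metricCoord g x₀) y a b c)
      (extChartAt (𝓡 (m + 2)) x₀).target := by
    have h1 : ContDiffOn ℝ ∞ (fun y ↦ fderiv ℝ (fun y' ↦ metricCoord g x₀ y' b c) y a)
        (extChartAt (𝓡 (m + 2)) x₀).target :=
      ((((contDiffOn_metricCoord g x₀).clm_apply contDiffOn_const).clm_apply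
        contDiffOn_const).fderiv_of_isOpen (isOpen_extChartAt_target x₀) (by simp)).clm_apply
        contDiffOn_const
    refine h1.congr fun y hy ↦ ?_
    have hd := (contDiffAt_metricCoord g hy).differentiableAt (by simp)
    rw [((hd.hasFDerivAt.clm_apply (hasFDerivAt_const b y)).clm_apply
      (hasFDerivAt_const c y)).fderiv]
    simp
  simp only [christoffelLow_apply]
  exact contDiffOn_const.mul (((hD u v w).add (hD v u w)).sub (hD w u v))

set_option synthInstance.maxHeartbeats 200000 in
theorem christoffelLow_add_left (g : LorentzMetric m M) (x₀ : M) (y : Model (m + 2)) 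
    (u u' v : Model (m + 2)) :
    christoffelLow g x₀ y (u + u') v = 
      christoffelLow g x₀ y u v + christoffelLow g x₀ y u' v := by
  ext w
  simp only [christoffelLow_apply, map_add, add_apply]
  ring

set_option synthInstance.maxHeartbeats 200000 in
theorem christoffelLow_smul_left (g : LorentzMetric m M) (x₀ : M) (y : Model (m + 2)) 
    (c : ℝ) (u v : Model (m + 2)) :
    christoffelLow g x₀ y (c • u) v = c • christoffelLow g x₀ y u v := by
  ext w
  simp only [christoffelLow_apply, map_smul, smul_apply, smul_eq_mul]
  ring

set_option synthInstance.maxHeartbeats 200000 in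
theorem christoffelLow_add_right (g : LorentzMetric m M) (x₀ : M) (y : Model (m + 2)) 
    (u v v' : Model (m + 2)) :
    christoffelLow g x₀ y u (v + v') = 
      christoffelLow g x₀ y u v + christoffelLow g x₀ y u v' := by
  ext w
  simp only [christoffelLow_apply, map_add, add_apply]
  ring

set_option synthInstance.maxHeartbeats 200000 in
theorem christoffelLow_smul_right (g : LorentzMetric m M) (x₀ : M) (y : Model (m + 2)) 
    (c : ℝ) (u v : Model (m + 2)) :
    christoffelLow g x₀ y u (c • v) = c • christoffelLow g x₀ y u v := by
  ext w
  simp only [christoffelLow_apply, map_smul, smul_apply, smul_eq_mul]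
  ring

/-- The Christoffel symbols of the second kind as a bilinear map. -/
noncomputable def christoffelCLM (g : LorentzMetric m M) (x₀ : M) (y : Model (m + 2)) :
    Model (m + 2) →L[ℝ] Model (m + 2) →L[ℝ] Model (m + 2) :=
  LinearMap.toContinuousLinearMap <| LinearMap.toContinuousLinearMap.toLinearMap ∘ₗ
    LinearMap.mk₂ ℝ (christoffel g x₀ y)
      (fun u u' v ↦ by simp only [christoffel, christoffelLow_add_left, map_add])
      (fun c u v ↦ by simp only [christoffel, christoffelLow_smul_left, map_smul])
      (fun u v v' ↦ by simp only [christoffel, christoffelLow_add_right, map_add])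
      (fun c u v ↦ by simp only [christoffel, christoffelLow_smul_right, map_smul])

theorem christoffelCLM_apply (g : LorentzMetric m M) (x₀ : M) (y u v : Model (m + 2)) :
    christoffelCLM g x₀ y u v = christoffel g x₀ y u v := rfl

theorem koszul_christoffelCLM (g : LorentzMetric m M) {x₀ : M} {y : Model (m + 2)}
    (hy : y ∈ (extChartAt (𝓡 (m + 2)) x₀).target) :
    Koszul (metricCoord g x₀) (christoffelCLM g x₀ y) y := by
  intro u v w
  rw [christoffelCLM_apply, christoffel, ← christoffelLow_apply]
  obtain ⟨e, he⟩ := isInvertible_metricCoord g hy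
  rw [← he, ContinuousLinearMap.inverse_equiv]
  simp

theorem differentiableAt_christoffelCLM (g : LorentzMetric m M) {x₀ : M} {y : Model (m + 2)}
    (hy : y ∈ (extChartAt (𝓡 (m + 2)) x₀).target) :
    DifferentiableAt ℝ (christoffelCLM g x₀) y := by
  have hc : ContDiffOn ℝ ∞ (christoffelCLM g x₀) (extChartAt (𝓡 (m + 2)) x₀).target := by
    refine contDiffOn_clm_apply.2 fun u ↦ contDiffOn_clm_apply.2 fun v ↦ fun y' hy' ↦ ?_
    have hi : ContDiffAt ℝ ∞ (fun y ↦ (metricCoord g x₀ y).inverse) y' :=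
      (isInvertible_metricCoord g hy').contDiffAt_map_inverse.comp y'
        (contDiffAt_metricCoord g hy')
    exact hi.contDiffWithinAt.clm_apply (contDiffOn_christoffelLow g x₀ u v y' hy')
  exact (hc.contDiffAt ((isOpen_extChartAt_target x₀).mem_nhds hy)).differentiableAt (by simp)

/-- `curvatureOp` differentiates the symbols with their two arguments frozen; this passes to the
derivative of the operator-valued map. -/
theorem fderiv_christoffel (g : LorentzMetric m M) {x₀ : M} {y : Model (m + 2)}
    (hy : y ∈ (extChartAt (𝓡 (m + 2)) x₀).target) (u v w : Model (m + 2)) :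
    fderiv ℝ (fun y' ↦ christoffel g x₀ y' v w) y u =
      fderiv ℝ (christoffelCLM g x₀) y u v w := by
  have hd := (differentiableAt_christoffelCLM g hy).hasFDerivAt
  have := ((hd.clm_apply (hasFDerivAt_const v y)).clm_apply (hasFDerivAt_const w y)).fderiv
  simp only [christoffelCLM_apply] at this
  rw [this]
  simp

theorem curvatureOp_eq (g : LorentzMetric m M) (x : M) (u v w : Model (m + 2)) :
    curvatureOp g x u v w = coordCurvature (christoffelCLM g x)
      (extChartAt (𝓡 (m + 2)) x x) u v w := by
  have hy : extChartAt (𝓡 (m + 2)) x x ∈ (extChartAt (𝓡 (m + 2)) x).target :=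
    mem_extChartAt_target x
  rw [coordCurvature, ← fderiv_christoffel g hy, ← fderiv_christoffel g hy]
  rfl

end Metric
-- Change of coordinates for Christoffel symbols and covariant derivatives.
section Transform

variable {X E : Type*} [NormedAddCommGroup X] [NormedSpace ℝ X]
  [NormedAddCommGroup E] [NormedSpace ℝ E]
  {G₀ G₁ : E → E →L[ℝ] E →L[ℝ] ℝ} {Γ₀ Γ₁ : E →L[ℝ] E →L[ℝ] E} {τ : E → E} {z : E}

/-- The transformation law of Christoffel symbols under a change of coordinates. -/
theorem Koszul.pullback (hτ : ContDiffAt ℝ 2 τ z)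
    (hG : ∀ᶠ z' in 𝓝 z, ∀ u v, G₁ z' u v = G₀ (τ z') (fderiv ℝ τ z' u) (fderiv ℝ τ z' v))
    (hd₁ : DifferentiableAt ℝ G₁ z) (hk₁ : Koszul G₁ Γ₁ z) (hk₀ : Koszul G₀ Γ₀ (τ z))
    (hd : DifferentiableAt ℝ G₀ (τ z)) (hs : ∀ᶠ z' in 𝓝 (τ z), ∀ u v, G₀ z' u v = G₀ z' v u)
    (hn : ∀ a, (∀ b, G₀ (τ z) a b = 0) → a = 0) (hsurj : Function.Surjective (fderiv ℝ τ z))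
    (u v : E) :
    fderiv ℝ τ z (Γ₁ u v) =
      fderiv ℝ (fderiv ℝ τ) z u v + Γ₀ (fderiv ℝ τ z u) (fderiv ℝ τ z v) := by
  have d0 : DifferentiableAt ℝ τ z := hτ.differentiableAt (by norm_num)
  have d1 : DifferentiableAt ℝ (fderiv ℝ τ) z :=
    (hτ.fderiv_right (m := 1) (by norm_num)).differentiableAt (by norm_num)
  have s2 : ∀ a b, fderiv ℝ (fderiv ℝ τ) z a b = fderiv ℝ (fderiv ℝ τ) z b a := fun a b ↦
    (hτ.isSymmSndFDerivAt (by simp)) a b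
  have hΓs := hk₀.symm hd hs hn
  have gs := hs.self_of_nhds
  have D : ∀ a b c, fderiv ℝ G₁ z a b c =
      G₀ (τ z) (fderiv ℝ (fderiv ℝ τ) z a b + Γ₀ (fderiv ℝ τ z a) (fderiv ℝ τ z b))
        (fderiv ℝ τ z c) +
      G₀ (τ z) (fderiv ℝ τ z b)
        (fderiv ℝ (fderiv ℝ τ) z a c + Γ₀ (fderiv ℝ τ z a) (fderiv ℝ τ z c)) := by
    intro a b c
    have e1 := hk₀.fderiv_inner hd hs d0 (hasFDerivAt_fderiv_apply d1 b).differentiableAt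
      (hasFDerivAt_fderiv_apply d1 c).differentiableAt a
    rw [(hasFDerivAt_fderiv_apply d1 b).fderiv, (hasFDerivAt_fderiv_apply d1 c).fderiv] at e1
    simp only [ContinuousLinearMap.flip_apply] at e1
    rw [← e1]
    have e2 : (fun z' ↦ G₁ z' b c) =ᶠ[𝓝 z]
        fun z' ↦ G₀ (τ z') (fderiv ℝ τ z' b) (fderiv ℝ τ z' c) := hG.mono fun z' h ↦ h b c
    rw [← e2.fderiv_eq, ((hd₁.hasFDerivAt.clm_apply (hasFDerivAt_const b z)).clm_apply
      (hasFDerivAt_const c z)).fderiv]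
    simp
  rw [← sub_eq_zero]
  refine hn _ fun W ↦ ?_
  -- By surjectivity test vectors of the form `dτ(w)` suffice, and on these the pairing is a
  -- `G₁`-pairing, to which the Koszul formula of `G₁` applies.
  obtain ⟨w, rfl⟩ := hsurj W
  rw [map_sub, sub_apply, ← hG.self_of_nhds, hk₁, D, D, D, s2 w u, s2 w v, s2 v u,
    hΓs (fderiv ℝ τ z w) (fderiv ℝ τ z u), hΓs (fderiv ℝ τ z w) (fderiv ℝ τ z v),
    hΓs (fderiv ℝ τ z v) (fderiv ℝ τ z u),
    gs (fderiv ℝ τ z v) (_ + Γ₀ (fderiv ℝ τ z u) (fderiv ℝ τ z w)),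
    gs (fderiv ℝ τ z u) (_ + Γ₀ (fderiv ℝ τ z v) (fderiv ℝ τ z w))]
  ring

variable {F : X → E} {Y : X → E} {y : X}

/-- The covariant derivative of a field along a map transforms like a vector under a change
of coordinates. -/
theorem Koszul.covariant (hτ : ContDiffAt ℝ 2 τ (F y))
    (hG : ∀ᶠ z' in 𝓝 (F y), ∀ u v, G₁ z' u v = G₀ (τ z') (fderiv ℝ τ z' u) (fderiv ℝ τ z' v))
    (hd₁ : DifferentiableAt ℝ G₁ (F y)) (hk₁ : Koszul G₁ Γ₁ (F y))
    (hk₀ : Koszul G₀ Γ₀ (τ (F y))) (hd : DifferentiableAt ℝ G₀ (τ (F y)))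
    (hs : ∀ᶠ z' in 𝓝 (τ (F y)), ∀ u v, G₀ z' u v = G₀ z' v u)
    (hn : ∀ a, (∀ b, G₀ (τ (F y)) a b = 0) → a = 0)
    (hsurj : Function.Surjective (fderiv ℝ τ (F y)))
    (hF : DifferentiableAt ℝ F y) (hY : DifferentiableAt ℝ Y y) (ξ : X) :
    fderiv ℝ τ (F y) (fderiv ℝ Y y ξ + Γ₁ (fderiv ℝ F y ξ) (Y y)) =
      fderiv ℝ (fun y' ↦ fderiv ℝ τ (F y') (Y y')) y ξ +
        Γ₀ (fderiv ℝ (fun y' ↦ τ (F y')) y ξ) (fderiv ℝ τ (F y) (Y y)) := by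
  have d0 : DifferentiableAt ℝ τ (F y) := hτ.differentiableAt (by norm_num)
  have d1 : DifferentiableAt ℝ (fderiv ℝ τ) (F y) :=
    (hτ.fderiv_right (m := 1) (by norm_num)).differentiableAt (by norm_num)
  -- The second derivative of `τ` produced by the product rule is exactly the inhomogeneous term in
  -- `Koszul.pullback`.
  rw [map_add, hk₁.pullback hτ hG hd₁ hk₀ hd hs hn hsurj,
    (hasFDerivAt_comp_map d0 hF).fderiv,
    ((hasFDerivAt_comp_map d1 hF).clm_apply hY.hasFDerivAt).fderiv]
  simp only [add_apply, ContinuousLinearMap.comp_apply, ContinuousLinearMap.flip_apply]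
  abel

end Transform

/-! ### Dictionary between derivatives on manifolds and derivatives in charts. -/

section Charts

variable {n : ℕ} {N : Type*} [TopologicalSpace N] [ChartedSpace (Model n) N]
    [IsManifold (𝓡 n) ∞ N] {x₀ x₁ z : N}

theorem contDiffAt_chart_transition (h₀ : z ∈ (chartAt (Model n) x₀).source)
    (h₁ : z ∈ (chartAt (Model n) x₁).source) :
    ContDiffAt ℝ ∞ (extChartAt (𝓡 n) x₀ ∘ (extChartAt (𝓡 n) x₁).symm)
      (extChartAt (𝓡 n) x₁ z) := by
  have := contDiffWithinAt_ext_coord_change (I := 𝓡 n) (n := ∞) x₀ x₁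
    (y := extChartAt (𝓡 n) x₁ z) (by
      rw [PartialEquiv.trans_source]
      refine ⟨(extChartAt (𝓡 n) x₁).map_source (by simpa using h₁), ?_⟩
      simp [h₁, h₀])
  rwa [modelWithCornersSelf_coe, Set.range_id, contDiffWithinAt_univ] at this

/-- Both component maps are coordinate changes out of the chart preferred at `z`; the cocycle
identity `tangentCoordChange_comp` relates them. -/
theorem comp_eq_fderiv_transition (h₀ : z ∈ (chartAt (Model n) x₀).source)
    (h₁ : z ∈ (chartAt (Model n) x₁).source) (v : TangentSpace (𝓡 n) z) :
    comp x₀ z v = fderiv ℝ (extChartAt (𝓡 n) x₀ ∘ (extChartAt (𝓡 n) x₁).symm)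
      (extChartAt (𝓡 n) x₁ z) (comp x₁ z v) := by
  have e (x : N) (hx : z ∈ (chartAt (Model n) x).source) :
      comp x z v = tangentCoordChange (𝓡 n) z x z (v : Model n) := by
    rw [comp, TangentBundle.continuousLinearMapAt_trivializationAt_eq_core hx]
    rfl
  have e' := tangentCoordChange_comp (I := 𝓡 n) (w := z) (x := x₁) (y := x₀) (z := z)
    (v := (v : Model n)) (by simp [h₀, h₁])
  rw [tangentCoordChange_def (x := x₁)] at e'
  simp only [modelWithCornersSelf_coe, Set.range_id, fderivWithin_univ] at e'
  rw [e x₁ h₁, e x₀ h₀, e']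

theorem contMDiffAt_extChartAt_symm_self (hz : z ∈ (chartAt (Model n) x₀).source) :
    ContMDiffAt 𝓘(ℝ, Model n) (𝓡 n) ∞ (extChartAt (𝓡 n) x₀).symm (extChartAt (𝓡 n) x₀ z) :=
  (contMDiffOn_extChartAt_symm x₀).contMDiffAt ((isOpen_extChartAt_target x₀).mem_nhds
    ((extChartAt (𝓡 n) x₀).map_source (by simpa using hz)))

theorem MDifferentiableAt.differentiableAt_comp_chart {E : Type*} [NormedAddCommGroup E]
    [NormedSpace ℝ E] {h : N → E} (hz : z ∈ (chartAt (Model n) x₀).source)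
    (hh : MDifferentiableAt (𝓡 n) 𝓘(ℝ, E) h z) :
    DifferentiableAt ℝ (fun y ↦ h ((extChartAt (𝓡 n) x₀).symm y)) (extChartAt (𝓡 n) x₀ z) := by
  rw [← mdifferentiableAt_iff_differentiableAt]
  exact MDifferentiableAt.comp (g := h) _
    (by rwa [(extChartAt (𝓡 n) x₀).left_inv (by simpa using hz)])
    ((contMDiffAt_extChartAt_symm_self hz).mdifferentiableAt (by simp))

theorem eventuallyEq_comp_chart {E P : Type*} [TopologicalSpace P] [ChartedSpace (Model n) P]
    {x₀ z : P} (h : P → E) (hz : z ∈ (chartAt (Model n) x₀).source) :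
    h =ᶠ[𝓝 z] (fun y ↦ h ((extChartAt (𝓡 n) x₀).symm y)) ∘ extChartAt (𝓡 n) x₀ := by
  filter_upwards [(chartAt (Model n) x₀).open_source.mem_nhds hz] with q hq
  simp only [Function.comp_apply]
  rw [(extChartAt (𝓡 n) x₀).left_inv (by simpa using hq)]

theorem mdifferentiableAt_of_comp_chart {E : Type*} [NormedAddCommGroup E]
    [NormedSpace ℝ E] {h : N → E} (hz : z ∈ (chartAt (Model n) x₀).source)
    (hh : DifferentiableAt ℝ (fun y ↦ h ((extChartAt (𝓡 n) x₀).symm y))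
      (extChartAt (𝓡 n) x₀ z)) : MDifferentiableAt (𝓡 n) 𝓘(ℝ, E) h z :=
  (hh.comp_mdifferentiableAt (mdifferentiableAt_extChartAt hz)).congr_of_eventuallyEq
    (eventuallyEq_comp_chart h hz)

theorem tendsto_chart_symm (hz : z ∈ (chartAt (Model n) x₀).source) :
    Filter.Tendsto (extChartAt (𝓡 n) x₀).symm (𝓝 (extChartAt (𝓡 n) x₀ z)) (𝓝 z) := by
  have := (contMDiffAt_extChartAt_symm_self hz).continuousAt.tendsto
  rwa [(extChartAt (𝓡 n) x₀).left_inv (by simpa using hz)] at this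

theorem mvfderiv_eq_fderiv_chart {E : Type*} [NormedAddCommGroup E] [NormedSpace ℝ E] {h : N → E}
    (hz : z ∈ (chartAt (Model n) x₀).source) (hh : MDifferentiableAt (𝓡 n) 𝓘(ℝ, E) h z)
    (v : TangentSpace (𝓡 n) z) :
    mvfderiv (𝓡 n) h z v = fderiv ℝ (fun y ↦ h ((extChartAt (𝓡 n) x₀).symm y))
      (extChartAt (𝓡 n) x₀ z) (comp x₀ z v) := by
  have he : MDifferentiableAt (𝓡 n) 𝓘(ℝ, Model n) (extChartAt (𝓡 n) x₀) z :=
    mdifferentiableAt_extChartAt hz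
  have hc : MDifferentiableAt 𝓘(ℝ, Model n) 𝓘(ℝ, E)
      (fun y ↦ h ((extChartAt (𝓡 n) x₀).symm y)) (extChartAt (𝓡 n) x₀ z) :=
    mdifferentiableAt_iff_differentiableAt.2 (MDifferentiableAt.differentiableAt_comp_chart hz hh)
  have key := ((eventuallyEq_comp_chart h hz).mfderiv_eq (I := 𝓡 n) (I' := 𝓘(ℝ, E))).trans
    (mfderiv_comp z hc he)
  rw [mfderiv_eq_fderiv] at key
  rw [comp, TangentBundle.continuousLinearMapAt_trivializationAt hz]
  exact congr($key v)

theorem fderiv_chart_map {k : ℕ} {P : Type*} [TopologicalSpace P] [ChartedSpace (Model k) P]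
    [IsManifold (𝓡 k) ∞ P] {f : N → P} {w₀ : P} (hz : z ∈ (chartAt (Model n) x₀).source)
    (hw : f z ∈ (chartAt (Model k) w₀).source) (hf : MDifferentiableAt (𝓡 n) (𝓡 k) f z)
    (v : TangentSpace (𝓡 n) z) :
    fderiv ℝ (fun y ↦ extChartAt (𝓡 k) w₀ (f ((extChartAt (𝓡 n) x₀).symm y)))
      (extChartAt (𝓡 n) x₀ z) (comp x₀ z v) = comp w₀ (f z) (mfderiv (𝓡 n) (𝓡 k) f z v) := by
  have he : MDifferentiableAt (𝓡 k) 𝓘(ℝ, Model k) (extChartAt (𝓡 k) w₀) (f z) :=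
    mdifferentiableAt_extChartAt hw
  rw [← mvfderiv_eq_fderiv_chart (h := fun x ↦ extChartAt (𝓡 k) w₀ (f x)) hz (he.comp z hf),
    comp, TangentBundle.continuousLinearMapAt_trivializationAt hw]
  exact congr($(mfderiv_comp z he hf) v)

end Charts
-- Chart independence of the covariant derivative along a map.
section Invariance

variable {m : ℕ} {M : Type*} [TopologicalSpace M]
  [ChartedSpace (Model (m + 2)) M] [IsManifold (𝓡 (m + 2)) ∞ M]

theorem metricCoord_eventually_pullback (g : LorentzMetric m M) {x₀ x₁ z : M}
    (h₀ : z ∈ (chartAt (Model (m + 2)) x₀).source) (h₁ : z ∈ (chartAt (Model (m + 2)) x₁).source) :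
    ∀ᶠ y in 𝓝 (extChartAt (𝓡 (m + 2)) x₁ z), ∀ u v, metricCoord g x₁ y u v =
      metricCoord g x₀ ((extChartAt (𝓡 (m + 2)) x₀ ∘ (extChartAt (𝓡 (m + 2)) x₁).symm) y)
        (fderiv ℝ (extChartAt (𝓡 (m + 2)) x₀ ∘ (extChartAt (𝓡 (m + 2)) x₁).symm) y u)
        (fderiv ℝ (extChartAt (𝓡 (m + 2)) x₀ ∘ (extChartAt (𝓡 (m + 2)) x₁).symm) y v) := by
  have hz : extChartAt (𝓡 (m + 2)) x₁ z ∈ (extChartAt (𝓡 (m + 2)) x₁).target :=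
    (extChartAt (𝓡 (m + 2)) x₁).map_source (by simpa using h₁)
  filter_upwards [(isOpen_extChartAt_target x₁).mem_nhds hz,
    (tendsto_chart_symm h₁).eventually ((chartAt (Model (m + 2)) x₀).open_source.mem_nhds h₀)]
    with y hy hy₀ u v
  have hy₁ : (extChartAt (𝓡 (m + 2)) x₁).symm y ∈ (chartAt (Model (m + 2)) x₁).source := by
    simpa using (extChartAt (𝓡 (m + 2)) x₁).map_target hy
  rw [metricCoord_apply g x₁, inner_eq_metricCoord g hy₀, comp_eq_fderiv_transition hy₀ hy₁,
    comp_eq_fderiv_transition hy₀ hy₁, comp_uncomp hy₁, comp_uncomp hy₁,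
    (extChartAt (𝓡 (m + 2)) x₁).right_inv hy]
  rfl

theorem surjective_fderiv_transition {n : ℕ} {N : Type*} [TopologicalSpace N]
    [ChartedSpace (Model n) N] [IsManifold (𝓡 n) ∞ N] {x₀ x₁ z : N}
    (h₀ : z ∈ (chartAt (Model n) x₀).source) (h₁ : z ∈ (chartAt (Model n) x₁).source) :
    Function.Surjective (fderiv ℝ (extChartAt (𝓡 n) x₀ ∘ (extChartAt (𝓡 n) x₁).symm)
      (extChartAt (𝓡 n) x₁ z)) := fun w ↦
  ⟨comp x₁ z (uncomp x₀ z w), by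
    rw [← comp_eq_fderiv_transition h₀ h₁, comp_uncomp h₀]⟩

variable {V : Type*} [TopologicalSpace V]
  [ChartedSpace (Model (m + 1)) V] [IsManifold (𝓡 (m + 1)) ∞ V]

/-- The covariant derivative along a map can be computed in arbitrary charts. -/
theorem comp_covDeriv (g : LorentzMetric m M) {f : V → M} {x₀ : M} {p q : V}
    (hq : q ∈ (chartAt (Model (m + 1)) p).source)
    (hfq : f q ∈ (chartAt (Model (m + 2)) x₀).source)
    {Y : (q : V) → TangentSpace (𝓡 (m + 2)) (f q)}
    (hY : ContMDiffAt (𝓡 (m + 1)) (𝓡 (m + 2)).tangent ∞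
      (fun q ↦ (⟨f q, Y q⟩ : TangentBundle (𝓡 (m + 2)) M)) q)
    (X : TangentSpace (𝓡 (m + 1)) q) :
    comp x₀ (f q) (covDeriv g f Y q X) =
      fderiv ℝ (fun y ↦ comp x₀ (f ((extChartAt (𝓡 (m + 1)) p).symm y))
          (Y ((extChartAt (𝓡 (m + 1)) p).symm y))) (extChartAt (𝓡 (m + 1)) p q) (comp p q X) +
        christoffelCLM g x₀ (extChartAt (𝓡 (m + 2)) x₀ (f q))
          (comp x₀ (f q) (dmap f q X)) (comp x₀ (f q) (Y q)) := by
  set ψ := extChartAt (𝓡 (m + 1)) p with hψ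
  set e₀ := extChartAt (𝓡 (m + 2)) x₀ with he₀
  set e₁ := extChartAt (𝓡 (m + 2)) (f q) with he₁
  set C : V → Model (m + 2) := fun q' ↦
    (trivializationAt (Model (m + 2)) (TangentSpace (𝓡 (m + 2)) : M → Type) (f q)
      (⟨f q', Y q'⟩ : TangentBundle (𝓡 (m + 2)) M)).2 with hC
  have hY' := Bundle.contMDiffAt_totalSpace.1 hY
  have hf : MDifferentiableAt (𝓡 (m + 1)) (𝓡 (m + 2)) f q := hY'.1.mdifferentiableAt (by simp)
  have hCd : MDifferentiableAt (𝓡 (m + 1)) 𝓘(ℝ, Model (m + 2)) C q :=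
    hY'.2.mdifferentiableAt (by simp)
  have hqs : q ∈ ψ.source := by simpa [hψ] using hq
  have hinv : ψ.symm (ψ q) = q := ψ.left_inv hqs
  have hf₁ : f q ∈ (chartAt (Model (m + 2)) (f q)).source := mem_chart_source _ _
  have hcψ : Filter.Tendsto ψ.symm (𝓝 (ψ q)) (𝓝 q) := tendsto_chart_symm hq
  have hev₁ : ∀ᶠ y in 𝓝 (ψ q), f (ψ.symm y) ∈ (chartAt (Model (m + 2)) (f q)).source :=
    hcψ.eventually (hf.continuousAt.eventually
      ((chartAt (Model (m + 2)) (f q)).open_source.mem_nhds hf₁))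
  have hev₀ : ∀ᶠ y in 𝓝 (ψ q), f (ψ.symm y) ∈ (chartAt (Model (m + 2)) x₀).source :=
    hcψ.eventually (hf.continuousAt.eventually
      ((chartAt (Model (m + 2)) x₀).open_source.mem_nhds hfq))
  set F : Model (m + 1) → Model (m + 2) := fun y ↦ e₁ (f (ψ.symm y)) with hF
  have hFq : F (ψ q) = e₁ (f q) := by rw [hF]; simp only [hinv]
  have hCq : C (ψ.symm (ψ q)) = comp (f q) (f q) (Y q) := by
    rw [hinv, hC]; exact trivializationAt_apply_snd hf₁ _
  have hFd : DifferentiableAt ℝ F (ψ q) :=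
    MDifferentiableAt.differentiableAt_comp_chart (h := fun q ↦ e₁ (f q)) hq
      ((mdifferentiableAt_extChartAt hf₁).comp q hf)
  have hCψ : DifferentiableAt ℝ (fun y ↦ C (ψ.symm y)) (ψ q) :=
    MDifferentiableAt.differentiableAt_comp_chart hq hCd
  set τ := e₀ ∘ e₁.symm with hτ
  have hτF : ∀ {q'}, f q' ∈ (chartAt (Model (m + 2)) (f q)).source →
      τ (e₁ (f q')) = e₀ (f q') := fun {q'} h ↦ by
    rw [hτ, Function.comp_apply, e₁.left_inv (by simpa [he₁] using h)]
  have htgt₀ : e₀ (f q) ∈ e₀.target := e₀.map_source (by simpa [he₀] using hfq)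
  have htgt₁ : e₁ (f q) ∈ e₁.target := e₁.map_source (by simp [he₁])
  -- `G₁` and `Γ₁` belong to the chart preferred at `f q`, in which `covDeriv` is defined; `G₀` and
  -- `Γ₀` belong to the chart at `x₀`, and `τ` is the transition between them.
  have key := Koszul.covariant (F := F) (Y := fun y ↦ C (ψ.symm y)) (y := ψ q) (τ := τ)
    (G₀ := metricCoord g x₀) (G₁ := metricCoord g (f q))
    (Γ₀ := christoffelCLM g x₀ (e₀ (f q))) (Γ₁ := christoffelCLM g (f q) (e₁ (f q)))
    (by rw [hFq]; exact (contDiffAt_chart_transition hfq hf₁).of_le ENat.LEInfty.out)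
    (by rw [hFq]; exact metricCoord_eventually_pullback g hfq hf₁)
    (by rw [hFq]; exact (contDiffAt_metricCoord g htgt₁).differentiableAt (by simp))
    (by rw [hFq]; exact koszul_christoffelCLM g htgt₁)
    (by rw [hFq, hτF hf₁]; exact koszul_christoffelCLM g htgt₀)
    (by rw [hFq, hτF hf₁]; exact (contDiffAt_metricCoord g htgt₀).differentiableAt (by simp))
    (Filter.Eventually.of_forall fun z u v ↦ metricCoord_symm g x₀ z u v)
    (by rw [hFq, hτF hf₁]; exact metricCoord_nondegenerate g htgt₀)
    (by rw [hFq]; exact surjective_fderiv_transition hfq hf₁)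
    hFd hCψ (comp p q X)
  have hcov : covDeriv g f Y q X = (fderiv ℝ (fun y ↦ C (ψ.symm y)) (ψ q) (comp p q X) +
      christoffelCLM g (f q) (e₁ (f q)) (fderiv ℝ F (ψ q) (comp p q X)) (C (ψ.symm (ψ q))) :
        Model (m + 2)) := by
    rw [← mvfderiv_eq_fderiv_chart hq hCd, fderiv_chart_map hq hf₁ hf, hCq, comp_self, comp_self]
    rfl
  rw [comp_eq_fderiv_transition hfq hf₁, comp_self, hcov]
  have a₁ : (fun y ↦ fderiv ℝ τ (F y) (C (ψ.symm y))) =ᶠ[𝓝 (ψ q)]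
      fun y ↦ comp x₀ (f (ψ.symm y)) (Y (ψ.symm y)) := by
    filter_upwards [hev₀, hev₁] with y h₀ h₁
    rw [comp_eq_fderiv_transition h₀ h₁, hC]
    exact congrArg _ (trivializationAt_apply_snd h₁ _)
  have a₂ : (fun y ↦ τ (F y)) =ᶠ[𝓝 (ψ q)] fun y ↦ e₀ (f (ψ.symm y)) :=
    hev₁.mono fun y h₁ ↦ hτF h₁
  have a₃ : fderiv ℝ τ (F (ψ q)) (C (ψ.symm (ψ q))) = comp x₀ (f q) (Y q) := by
    rw [hFq, hCq, ← comp_eq_fderiv_transition hfq hf₁]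
  rw [a₁.fderiv_eq, a₂.fderiv_eq, a₃, fderiv_chart_map hq hfq hf] at key
  rw [← key, hFq]

end Invariance
-- Umbilicity for all tangent vectors, and the curvature formula in coordinates.
section Umbilic

variable {X E ι : Type*} [NormedAddCommGroup X] [NormedSpace ℝ X]
  [NormedAddCommGroup E] [NormedSpace ℝ E]
  {G : E → E →L[ℝ] E →L[ℝ] ℝ} {Γ : E → E →L[ℝ] E →L[ℝ] E} {F : X → E} {y : X}

/-- The term with the derivative of `A` is tangential, so it disappears on pairing with the null
normal; the second fundamental form thus depends only on the value of `A` at the point. -/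
theorem fderiv_fderiv_apply_field (hF : DifferentiableAt ℝ (fderiv ℝ F) y) {A : X → X}
    (hA : DifferentiableAt ℝ A y) (u : X) :
    fderiv ℝ (fun y' ↦ fderiv ℝ F y' (A y')) y u + Γ (F y) (fderiv ℝ F y u) (fderiv ℝ F y (A y)) =
      hessianField Γ F y u (A y) + fderiv ℝ F y (fderiv ℝ A y u) := by
  rw [(hF.hasFDerivAt.clm_apply hA.hasFDerivAt).fderiv]
  simp only [hessianField, add_apply, ContinuousLinearMap.comp_apply,
    ContinuousLinearMap.flip_apply]
  abel

/-- Umbilicity, stated for the fields of an isotropic frame, holds for all pairs of vectors. -/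
theorem inner_hessianField_of_frame {e₁ : X → X} {e : ι → X → X} {l : ℝ}
    (hF : ContDiffAt ℝ 3 F y) (hd : DifferentiableAt ℝ G (F y))
    (hs : ∀ᶠ z' in 𝓝 (F y), ∀ a b, G z' a b = G z' b a)
    (hn : ∀ a, (∀ b, G (F y) a b = 0) → a = 0) (hk : Koszul G (Γ (F y)) (F y))
    (he₁ : DifferentiableAt ℝ e₁ y) (he : ∀ a, DifferentiableAt ℝ (e a) y)
    (hspan : ⊤ ≤ Submodule.span ℝ (insert (e₁ y) (Set.range fun a ↦ e a y)))
    (h₁₁ : ∀ᶠ y' in 𝓝 y, G (F y') (fderiv ℝ F y' (e₁ y')) (fderiv ℝ F y' (e₁ y')) = 0)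
    (horth : ∀ v, G (F y) (fderiv ℝ F y (e₁ y)) (fderiv ℝ F y v) = 0)
    (humb : ∀ a b, G (F y) (fderiv ℝ (fun y' ↦ fderiv ℝ F y' (e a y')) y (e b y)
        + Γ (F y) (fderiv ℝ F y (e b y)) (fderiv ℝ F y (e a y))) (fderiv ℝ F y (e₁ y)) =
      -l * G (F y) (fderiv ℝ F y (e a y)) (fderiv ℝ F y (e b y))) (u v : X) :
    G (F y) (fderiv ℝ F y (e₁ y)) (hessianField Γ F y u v) =
      -l * G (F y) (fderiv ℝ F y u) (fderiv ℝ F y v) := by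
  have d0 := hF.differentiableAt (by norm_num)
  have d1 : DifferentiableAt ℝ (fderiv ℝ F) y :=
    (hF.fderiv_right (m := 2) (by norm_num)).differentiableAt (by norm_num)
  have gs := hs.self_of_nhds
  have hHs : ∀ a b, hessianField Γ F y a b = hessianField Γ F y b a := fun a b ↦ by
    rw [hessianField, hessianField, (hF.isSymmSndFDerivAt (by simp; norm_num)) a b,
      hk.symm hd hs hn]
  have dK : DifferentiableAt ℝ (fun y' ↦ fderiv ℝ F y' (e₁ y')) y := d1.clm_apply he₁
  -- Differentiating `(e₁, e₁) = 0` kills the left side; the right side vanishes because `e₁` is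
  -- orthogonal to all tangent vectors.
  have hB₁ : ∀ u, G (F y) (fderiv ℝ F y (e₁ y)) (hessianField Γ F y u (e₁ y)) =
      -l * G (F y) (fderiv ℝ F y u) (fderiv ℝ F y (e₁ y)) := fun u ↦ by
    have h1 := hk.fderiv_inner hd hs d0 dK dK u
    have h2 : (fun y' ↦ G (F y') (fderiv ℝ F y' (e₁ y')) (fderiv ℝ F y' (e₁ y'))) =ᶠ[𝓝 y]
        fun _ ↦ 0 := h₁₁
    rw [h2.fderiv_eq, fderiv_fun_const, fderiv_fderiv_apply_field d1 he₁, gs (_ + _), map_add,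
      horth] at h1
    simp only [Pi.zero_apply, zero_apply] at h1
    rw [gs (fderiv ℝ F y u), horth]
    linarith
  have hBe : ∀ a b, G (F y) (fderiv ℝ F y (e₁ y)) (hessianField Γ F y (e b y) (e a y)) =
      -l * G (F y) (fderiv ℝ F y (e b y)) (fderiv ℝ F y (e a y)) := fun a b ↦ by
    have h1 := humb a b
    rw [fderiv_fderiv_apply_field d1 (he a), gs (_ + _), map_add, horth, add_zero] at h1
    rw [h1, gs (fderiv ℝ F y (e b y))]
  -- The two sides as linear functionals of the second argument. Both are symmetric, so equality on
  -- the frame extends first in one slot and then, after a swap, in the other.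
  let L : X → X →L[ℝ] ℝ := fun u ↦ (G (F y) (fderiv ℝ F y (e₁ y))).comp
    (fderiv ℝ (fderiv ℝ F) y u + (Γ (F y) (fderiv ℝ F y u)).comp (fderiv ℝ F y))
  let L' : X → X →L[ℝ] ℝ := fun u ↦ -l • (G (F y) (fderiv ℝ F y u)).comp (fderiv ℝ F y)
  have ext (u : X) (h1 : L u (e₁ y) = L' u (e₁ y)) (h2 : ∀ a, L u (e a y) = L' u (e a y)) (v : X) :
      L u v = L' u v := by
    have : (L u).toLinearMap = (L' u).toLinearMap := by
      refine LinearMap.ext_on (top_le_iff.1 hspan) ?_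
      rintro _ (rfl | ⟨a, rfl⟩)
      · exact h1
      · exact h2 a
    exact congr($this v)
  have symmL : ∀ u v, L u v = L v u := fun u v ↦
    congrArg (G (F y) (fderiv ℝ F y (e₁ y))) (hHs u v)
  have symmL' : ∀ u v, L' u v = L' v u := fun u v ↦ congrArg (-l * ·) (gs _ _)
  refine ext u (hB₁ u) (fun a ↦ ?_) v
  rw [symmL, symmL']
  exact ext _ (hB₁ _) (fun b ↦ hBe _ _) u

/-- The isotropic sectional curvature of a totally umbilical lightlike hypersurface, in
coordinates. -/
theorem inner_curvature_of_frame {e₁ : X → X} {e : ι → X → X} {lam : X → ℝ} {N : E} {u : X}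
    (hF : ∀ᶠ y' in 𝓝 y, ContDiffAt ℝ 3 F y') (hΓ : DifferentiableAt ℝ Γ (F y))
    (hd : ∀ᶠ y' in 𝓝 y, DifferentiableAt ℝ G (F y'))
    (hs : ∀ z' a b, G z' a b = G z' b a)
    (hn : ∀ᶠ y' in 𝓝 y, ∀ a, (∀ b, G (F y') a b = 0) → a = 0)
    (hk : ∀ᶠ y' in 𝓝 y, Koszul G (Γ (F y')) (F y'))
    (he₁ : ∀ᶠ y' in 𝓝 y, DifferentiableAt ℝ e₁ y')
    (he : ∀ᶠ y' in 𝓝 y, ∀ a, DifferentiableAt ℝ (e a) y')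
    (hspan : ∀ᶠ y' in 𝓝 y, ⊤ ≤ Submodule.span ℝ (insert (e₁ y') (Set.range fun a ↦ e a y')))
    (h₁₁ : ∀ᶠ y' in 𝓝 y, G (F y') (fderiv ℝ F y' (e₁ y')) (fderiv ℝ F y' (e₁ y')) = 0)
    (h₁ₑ : ∀ᶠ y' in 𝓝 y, ∀ a, G (F y') (fderiv ℝ F y' (e₁ y')) (fderiv ℝ F y' (e a y')) = 0)
    (humb : ∀ᶠ y' in 𝓝 y, ∀ a b, G (F y') (fderiv ℝ (fun y' ↦ fderiv ℝ F y' (e a y')) y' (e b y')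
        + Γ (F y') (fderiv ℝ F y' (e b y')) (fderiv ℝ F y' (e a y'))) (fderiv ℝ F y' (e₁ y')) =
      -lam y' * G (F y') (fderiv ℝ F y' (e a y')) (fderiv ℝ F y' (e b y')))
    (hN : G (F y) (fderiv ℝ F y (e₁ y)) N = -1)
    (hNspan : ∀ W, G (F y) W N = 0 → (∀ v, G (F y) W (fderiv ℝ F y v) = 0) → W = 0)
    (hu : G (F y) (fderiv ℝ F y u) (fderiv ℝ F y u) ≠ 0) :
    DifferentiableAt ℝ lam y ∧
    G (F y) (fderiv ℝ F y (e₁ y)) (coordCurvature Γ (F y) (fderiv ℝ F y u)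
        (fderiv ℝ F y (e₁ y)) (fderiv ℝ F y u)) =
      (fderiv ℝ lam y (e₁ y) + lam y * G (F y) (fderiv ℝ (fun y' ↦ fderiv ℝ F y' (e₁ y')) y (e₁ y)
        + Γ (F y) (fderiv ℝ F y (e₁ y)) (fderiv ℝ F y (e₁ y))) N + lam y ^ 2) *
        G (F y) (fderiv ℝ F y u) (fderiv ℝ F y u) := by
  have horth : ∀ᶠ y' in 𝓝 y, ∀ v, G (F y') (fderiv ℝ F y' (e₁ y')) (fderiv ℝ F y' v) = 0 := by
    filter_upwards [hspan, h₁₁, h₁ₑ] with y' hsp h1 h2 v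
    have : ((G (F y') (fderiv ℝ F y' (e₁ y'))).comp (fderiv ℝ F y')).toLinearMap = 0 := by
      refine LinearMap.ext_on (top_le_iff.1 hsp) ?_
      rintro _ (rfl | ⟨a, rfl⟩)
      · exact h1
      · exact h2 a
    exact congr($this v)
  have hs' : ∀ z, ∀ᶠ z' in 𝓝 z, ∀ a b, G z' a b = G z' b a := fun z ↦
    Filter.Eventually.of_forall hs
  have humb' : ∀ᶠ y' in 𝓝 y, ∀ a b, G (F y') (fderiv ℝ F y' (e₁ y')) (hessianField Γ F y' a b) =
      -lam y' * G (F y') (fderiv ℝ F y' a) (fderiv ℝ F y' b) := by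
    filter_upwards [hF, hd, hn, hk, he₁, he, hspan, h₁₁.eventually_nhds, horth, humb] with y'
      hF hd hn hk he₁ he hspan h₁₁ horth humb
    exact inner_hessianField_of_frame hF hd (hs' _) hn hk he₁ he hspan h₁₁ horth humb
  have hF₀ := hF.self_of_nhds
  have hd₀ := hd.self_of_nhds
  have hk₀ := hk.self_of_nhds
  have d0 := hF₀.differentiableAt (by norm_num)
  have d1 : DifferentiableAt ℝ (fderiv ℝ F) y :=
    (hF₀.fderiv_right (m := 2) (by norm_num)).differentiableAt (by norm_num)
  have dF := fun a ↦ (hasFDerivAt_fderiv_apply d1 a).differentiableAt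
  have dK : DifferentiableAt ℝ (fun y' ↦ fderiv ℝ F y' (e₁ y')) y :=
    d1.clm_apply he₁.self_of_nhds
  -- No regularity of `lam` is assumed. With the nonisotropic vector `u` held fixed, umbilicity
  -- expresses `lam` near `y` as minus the quotient of `(K, H(u,u))` by `(df u, df u)`, which is
  -- differentiable.
  have hlam : DifferentiableAt ℝ lam y := by
    obtain ⟨S, hS, -⟩ := hasFDerivAt_hessianField hF₀ hΓ u u
    obtain ⟨T, hT, -⟩ := exists_hasFDerivAt_bilin hd₀ d0 dK hS.differentiableAt
    obtain ⟨T', hT', -⟩ := exists_hasFDerivAt_bilin hd₀ d0 (dF u) (dF u)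
    have hq := hT.differentiableAt.fun_neg.fun_mul (hT'.differentiableAt.fun_inv hu)
    refine hq.congr_of_eventuallyEq ?_
    filter_upwards [humb', hT'.continuousAt.eventually_ne hu] with y' h1 h2
    rw [h1, ← div_eq_mul_inv, eq_div_iff h2]
    ring
  -- Since `(K, N) = -1`, this choice makes `∇_a K - λ df(a) - γ(a) K` orthogonal to `N`; it is the
  -- form `ω₁¹ - λ ω¹`.
  set γ : X → ℝ := fun a ↦ lam y * G (F y) (fderiv ℝ F y a) N -
    G (F y) (fderiv ℝ (fun y' ↦ fderiv ℝ F y' (e₁ y')) y a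
      + Γ (F y) (fderiv ℝ F y a) (fderiv ℝ F y (e₁ y))) N with hγ
  have hdec : ∀ a W, G (F y) (fderiv ℝ (fun y' ↦ fderiv ℝ F y' (e₁ y')) y a
        + Γ (F y) (fderiv ℝ F y a) (fderiv ℝ F y (e₁ y))) W =
      lam y * G (F y) (fderiv ℝ F y a) W + γ a * G (F y) (fderiv ℝ F y (e₁ y)) W := by
    intro a W
    have hzero := hNspan (fderiv ℝ (fun y' ↦ fderiv ℝ F y' (e₁ y')) y a
        + Γ (F y) (fderiv ℝ F y a) (fderiv ℝ F y (e₁ y)) - lam y • fderiv ℝ F y a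
        - γ a • fderiv ℝ F y (e₁ y))
      (by
        rw [map_sub, map_sub, map_smul, map_smul]
        simp only [sub_apply, smul_apply, smul_eq_mul]
        rw [hN, hγ]
        ring)
      (fun v ↦ by
        -- Orthogonality to tangent vectors: differentiating `(K, df v) = 0` gives `(∇_a K, df v) =
        -- -(K, H(a,v)) = λ (df a, df v)`.
        have h1 := hk₀.fderiv_inner hd₀ (hs' _) d0 dK (dF v) a
        have h2 : (fun y' ↦ G (F y') (fderiv ℝ F y' (e₁ y')) (fderiv ℝ F y' v)) =ᶠ[𝓝 y]
            fun _ ↦ 0 := horth.mono fun _ h ↦ h v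
        have h3 := humb'.self_of_nhds a v
        rw [hessianField] at h3
        rw [h2.fderiv_eq, fderiv_fun_const, (hasFDerivAt_fderiv_apply d1 v).fderiv,
          ContinuousLinearMap.flip_apply, h3] at h1
        simp only [Pi.zero_apply, zero_apply] at h1
        rw [map_sub, map_sub, map_smul, map_smul]
        simp only [sub_apply, smul_apply, smul_eq_mul]
        rw [horth.self_of_nhds]
        linarith)
    rw [sub_sub, sub_eq_zero] at hzero
    rw [hzero]
    simp
  have key := inner_curvature_of_umbilic (K := fun y' ↦ fderiv ℝ F y' (e₁ y')) (γ := γ) (e₁ y) u u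
    hF₀ hΓ hd₀ (hs' _) hn.self_of_nhds hk₀ dK hlam rfl horth.self_of_nhds humb' hdec
  refine ⟨hlam, ?_⟩
  -- The term `λ²` of `μ` comes from `-λ γ(e₁)`, again through `(K, N) = -1`.
  rw [key, hγ]
  simp only [hN]
  ring

end Umbilic
-- Linear algebra and smoothness of isotropic frames.
section Hypersurface

variable {m : ℕ} {M : Type*} [TopologicalSpace M]
  [ChartedSpace (Model (m + 2)) M] [IsManifold (𝓡 (m + 2)) ∞ M]
  {V : Type*} [TopologicalSpace V]
  [ChartedSpace (Model (m + 1)) V] [IsManifold (𝓡 (m + 1)) ∞ V]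
  {g : LorentzMetric m M} {f : V → M} {U : Set V}

namespace IsotropicFrame

variable (F : IsotropicFrame g f U) {p : V}

theorem e₁_ne_zero (hp : p ∈ U) : F.e₁ p ≠ 0 := fun h ↦ by
  simpa [h] using F.g_e₁_en p hp

/-- All products involving `e₁` vanish, so the square of the vector is `g_{ab} dᵃ dᵇ`, and `g_{ab}`
is positive definite. -/
theorem coeff_eq_zero (hp : p ∈ U) {c : ℝ} {d : Fin m → ℝ}
    (h : g.val (f p) (dmap f p (c • F.e₁ p + ∑ a, d a • F.e a p))
      (dmap f p (c • F.e₁ p + ∑ a, d a • F.e a p)) = 0) : d = 0 := by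
  by_contra hd
  refine (F.g_e_pos p hp d hd).ne' ?_
  have h' : ∀ a, g.val (f p) (dmap f p (F.e a p)) (dmap f p (F.e₁ p)) = 0 := fun a ↦ by
    rw [g.symm]; exact F.g_e₁_e p hp a
  simp only [map_add, map_smul, map_sum, add_apply, smul_apply, sum_apply, smul_eq_mul,
    F.g_e₁_e₁ p hp, F.g_e₁_e p hp, h'] at h
  simp only [mul_zero, Finset.sum_const_zero, zero_add, Finset.mul_sum] at h
  rw [← h, Finset.sum_comm]
  refine Finset.sum_congr rfl fun a _ ↦ Finset.sum_congr rfl fun b _ ↦ ?_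
  ring

theorem linearIndependent (hp : p ∈ U) :
    LinearIndependent ℝ (fun o : Option (Fin m) ↦ o.elim (F.e₁ p) (fun a ↦ F.e a p)) := by
  rw [Fintype.linearIndependent_iff]
  intro d hd
  rw [Fintype.sum_option] at hd
  simp only [Option.elim] at hd
  have h1 : (fun a ↦ d (some a)) = 0 := F.coeff_eq_zero hp (c := d none) (by
    rw [hd]; simp)
  have h2 : ∀ a, d (some a) = 0 := fun a ↦ congrFun h1 a
  simp only [h2, zero_smul, Finset.sum_const_zero, add_zero, smul_eq_zero, F.e₁_ne_zero hp,
    or_false] at hd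
  rintro (_ | a)
  · exact hd
  · exact h2 a

theorem span_eq_top (hp : p ∈ U) :
    Submodule.span ℝ (insert (F.e₁ p) (Set.range fun a ↦ F.e a p)) = ⊤ := by
  have : FiniteDimensional ℝ (TangentSpace (𝓡 (m + 1)) p) :=
    inferInstanceAs (FiniteDimensional ℝ (Model (m + 1)))
  have := (F.linearIndependent hp).span_eq_top_of_card_eq_finrank' (by
    rw [Fintype.card_option, Fintype.card_fin]
    exact (finrank_euclideanSpace_fin (𝕜 := ℝ) (n := m + 1)).symm)
  rw [← this]
  congr 1
  ext v
  simp [Option.exists, eq_comm]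

theorem exists_coeff (hp : p ∈ U) (X : TangentSpace (𝓡 (m + 1)) p) :
    ∃ (c : ℝ) (d : Fin m → ℝ), X = c • F.e₁ p + ∑ a, d a • F.e a p := by
  have hX : X ∈ Submodule.span ℝ (insert (F.e₁ p) (Set.range fun a ↦ F.e a p)) := by
    rw [F.span_eq_top hp]; trivial
  obtain ⟨c, z, hz, rfl⟩ := Submodule.mem_span_insert.1 hX
  obtain ⟨d, rfl⟩ := (Submodule.mem_span_range_iff_exists_fun ℝ).1 hz
  exact ⟨c, d, rfl⟩

/-- Isotropic vectors of a lightlike hypersurface are multiples of `e₁`. -/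
theorem eq_smul_vec₁ (hp : p ∈ U) {P : TangentSpace (𝓡 (m + 2)) (f p)}
    (hP : P ∈ tangentHyperplane f p) (h : g.val (f p) P P = 0) : ∃ c : ℝ, P = c • F.vec₁ p := by
  obtain ⟨X, rfl⟩ := hP
  obtain ⟨c, d, rfl⟩ := F.exists_coeff hp X
  have hd := F.coeff_eq_zero hp h
  refine ⟨c, ?_⟩
  simp [hd, vec₁]

/-- A plane consisting of isotropic tangent vectors would lie in the line spanned by `e₁`. -/
theorem exists_inner_ne_zero (F : IsotropicFrame g f U) {p : V} (hp : p ∈ U)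
    {σ : Submodule ℝ (TangentSpace (𝓡 (m + 2)) (f p))} (hσ : Module.finrank ℝ σ = 2) (hle : σ ≤ tangentHyperplane f p) :
    ∃ P ∈ σ, g.val (f p) P P ≠ 0 := by
  by_contra! h
  have h1 : σ ≤ Submodule.span ℝ {F.vec₁ p} := fun P hP ↦ by
    obtain ⟨c, rfl⟩ := F.eq_smul_vec₁ hp (hle hP) (h P hP)
    exact Submodule.smul_mem _ _ (Submodule.mem_span_singleton_self _)
  have : FiniteDimensional ℝ (TangentSpace (𝓡 (m + 2)) (f p)) :=
    inferInstanceAs (FiniteDimensional ℝ (Model (m + 2)))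
  have h2 := Submodule.finrank_mono h1
  have h3 := finrank_span_le_card (R := ℝ) ({F.vec₁ p} : Set (TangentSpace (𝓡 (m + 2)) (f p)))
  rw [Set.toFinset_singleton, Finset.card_singleton] at h3
  omega

theorem inner_vec₁_dmap (hp : p ∈ U) (X : TangentSpace (𝓡 (m + 1)) p) :
    g.val (f p) (F.vec₁ p) (dmap f p X) = 0 := by
  obtain ⟨c, d, rfl⟩ := F.exists_coeff hp X
  simp [vec₁, F.g_e₁_e₁ p hp, F.g_e₁_e p hp]

/-- The tangent hyperplane and `eₙ` span the whole tangent space: `e₁` is orthogonal to the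
hyperplane but not to `eₙ`, so `eₙ` is transversal, and the dimensions add up. -/
theorem eq_zero_of_inner (hf : IsLightlikeHypersurface g f) (hp : p ∈ U)
    {W : TangentSpace (𝓡 (m + 2)) (f p)} (hW : g.val (f p) W (F.en p) = 0)
    (hWX : ∀ X, g.val (f p) W (dmap f p X) = 0) : W = 0 := by
  have : FiniteDimensional ℝ (TangentSpace (𝓡 (m + 2)) (f p)) :=
    inferInstanceAs (FiniteDimensional ℝ (Model (m + 2)))
  refine g.nondegenerate _ W fun w ↦ ?_
  set S := tangentHyperplane (m := m) f p
  have hS : Module.finrank ℝ S = m + 1 := by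
    rw [show Module.finrank ℝ S = _ from LinearMap.finrank_range_of_inj (hf.injective p)]
    exact finrank_euclideanSpace_fin
  have hen : F.en p ∉ S := by
    rintro ⟨X, hX⟩
    have h1 := F.inner_vec₁_dmap hp X
    rw [show dmap f p X = F.en p from hX, vec₁, F.g_e₁_en p hp] at h1
    norm_num at h1
  have hlt : S < S ⊔ Submodule.span ℝ {F.en p} := by
    refine lt_of_le_of_ne le_sup_left fun h ↦ hen ?_
    rw [h]
    exact Submodule.mem_sup_right (Submodule.mem_span_singleton_self _)
  have htop : S ⊔ Submodule.span ℝ {F.en p} = ⊤ := by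
    refine Submodule.eq_top_of_finrank_eq (le_antisymm (Submodule.finrank_le _) ?_)
    have h1 := Submodule.finrank_lt_finrank_of_lt hlt
    have h2 : Module.finrank ℝ (TangentSpace (𝓡 (m + 2)) (f p)) = m + 2 :=
      finrank_euclideanSpace_fin
    omega
  have hw : w ∈ S ⊔ Submodule.span ℝ {F.en p} := by rw [htop]; trivial
  have hle : S ⊔ Submodule.span ℝ {F.en p} ≤ LinearMap.ker (g.val (f p) W).toLinearMap := by
    refine sup_le ?_ ?_
    · rintro _ ⟨X, rfl⟩
      exact hWX X
    · rw [Submodule.span_singleton_le_iff_mem]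
      exact hW
  exact hle hw

end IsotropicFrame

/-- The components of a smooth tangent field in the chart are differentiable. -/
theorem differentiableAt_comp_field {n : ℕ} {N : Type*} [TopologicalSpace N]
    [ChartedSpace (Model n) N] [IsManifold (𝓡 n) ∞ N] {x₀ z : N}
    (hz : z ∈ (chartAt (Model n) x₀).source) {A : (q : N) → TangentSpace (𝓡 n) q}
    (hA : ContMDiffAt (𝓡 n) (𝓡 n).tangent ∞ (fun q ↦ (⟨q, A q⟩ : TangentBundle (𝓡 n) N)) z) :
    DifferentiableAt ℝ (fun y ↦ comp x₀ ((extChartAt (𝓡 n) x₀).symm y)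
      (A ((extChartAt (𝓡 n) x₀).symm y))) (extChartAt (𝓡 n) x₀ z) := by
  have h1 := ((trivializationAt (Model n) (TangentSpace (𝓡 n) : N → Type)
    x₀).contMDiffAt_section_iff (by simpa using hz)).1 hA
  have h2 : MDifferentiableAt (𝓡 n) 𝓘(ℝ, Model n) (fun q ↦ comp x₀ q (A q)) z := by
    refine (h1.mdifferentiableAt (by simp)).congr_of_eventuallyEq ?_
    filter_upwards [(chartAt (Model n) x₀).open_source.mem_nhds hz] with q hq
    exact (trivializationAt_apply_snd hq _).symm
  exact MDifferentiableAt.differentiableAt_comp_chart (h := fun q ↦ comp x₀ q (A q)) hz h2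

theorem contDiffAt_chart_map {n k : ℕ} {N : Type*} [TopologicalSpace N]
    [ChartedSpace (Model n) N] [IsManifold (𝓡 n) ∞ N] {P : Type*} [TopologicalSpace P]
    [ChartedSpace (Model k) P] [IsManifold (𝓡 k) ∞ P] {h : N → P} {x₀ z : N} {w₀ : P}
    (hz : z ∈ (chartAt (Model n) x₀).source) (hw : h z ∈ (chartAt (Model k) w₀).source)
    (hh : ContMDiffAt (𝓡 n) (𝓡 k) ∞ h z) :
    ContDiffAt ℝ ∞ (fun y ↦ extChartAt (𝓡 k) w₀ (h ((extChartAt (𝓡 n) x₀).symm y)))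
      (extChartAt (𝓡 n) x₀ z) := by
  rw [← contMDiffAt_iff_contDiffAt]
  have h1 : ContMDiffAt (𝓡 n) 𝓘(ℝ, Model k) ∞ (fun q ↦ extChartAt (𝓡 k) w₀ (h q))
      ((extChartAt (𝓡 n) x₀).symm (extChartAt (𝓡 n) x₀ z)) := by
    rw [(extChartAt (𝓡 n) x₀).left_inv (by simpa using hz)]
    exact (contMDiffAt_extChartAt' hw).comp z hh
  exact h1.comp _ (contMDiffAt_extChartAt_symm_self hz)

/-- A property holds near the image of a point in a chart if it holds near the point. -/
theorem eventually_chart {n : ℕ} {N : Type*} [TopologicalSpace N] [ChartedSpace (Model n) N]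
    [IsManifold (𝓡 n) ∞ N] {x : N} {Q : Model n → Prop}
    (h : ∀ᶠ q in 𝓝 x, Q (extChartAt (𝓡 n) x q)) : ∀ᶠ y in 𝓝 (extChartAt (𝓡 n) x x), Q y := by
  filter_upwards [(tendsto_chart_symm (mem_chart_source _ x)).eventually h,
    (isOpen_extChartAt_target x).mem_nhds (mem_extChartAt_target x)] with y hy hy'
  rwa [(extChartAt (𝓡 n) x).right_inv hy'] at hy

theorem IsotropicFrame.contMDiffAt_vec₁ (F : IsotropicFrame g f U) (hU : IsOpen U)
    (hf : ContMDiff (𝓡 (m + 1)) (𝓡 (m + 2)) ∞ f) {q : V} (hq : q ∈ U) :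
    ContMDiffAt (𝓡 (m + 1)) (𝓡 (m + 2)).tangent ∞
      (fun q ↦ (⟨f q, F.vec₁ q⟩ : TangentBundle (𝓡 (m + 2)) M)) q :=
  ContMDiffAt.comp (g := tangentMap (𝓡 (m + 1)) (𝓡 (m + 2)) f) q
    (hf.contMDiff_tangentMap (by simp)).contMDiffAt
    (F.smooth_e₁.contMDiffAt (hU.mem_nhds hq))

theorem IsotropicFrame.contMDiffAt_vec (F : IsotropicFrame g f U) (hU : IsOpen U)
    (hf : ContMDiff (𝓡 (m + 1)) (𝓡 (m + 2)) ∞ f) (a : Fin m) {q : V} (hq : q ∈ U) :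
    ContMDiffAt (𝓡 (m + 1)) (𝓡 (m + 2)).tangent ∞
      (fun q ↦ (⟨f q, F.vec a q⟩ : TangentBundle (𝓡 (m + 2)) M)) q :=
  ContMDiffAt.comp (g := tangentMap (𝓡 (m + 1)) (𝓡 (m + 2)) f) q
    (hf.contMDiff_tangentMap (by simp)).contMDiffAt
    ((F.smooth_e a).contMDiffAt (hU.mem_nhds hq))

end Hypersurface
set_option synthInstance.maxHeartbeats 200000 in
theorem coordCurvature_smul {E : Type*} [NormedAddCommGroup E] [NormedSpace ℝ E]
    (Γ : E → E →L[ℝ] E →L[ℝ] E) (z u v w : E) (c : ℝ) :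
    coordCurvature Γ z u (c • v) w = c • coordCurvature Γ z u v w := by
  simp only [coordCurvature, map_smul, smul_apply, smul_sub, smul_add]

/-! ### Transfer to the manifold and the isotropic sectional curvature. -/

section Main

variable {m : ℕ} {M : Type*} [TopologicalSpace M]
  [ChartedSpace (Model (m + 2)) M] [IsManifold (𝓡 (m + 2)) ∞ M]
  {V : Type*} [TopologicalSpace V]
  [ChartedSpace (Model (m + 1)) V] [IsManifold (𝓡 (m + 1)) ∞ V]
  {g : LorentzMetric m M} {f : V → M} {U : Set V}

/-- Everything near `p` is read in the charts preferred at `p` and `f p`, and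
`inner_curvature_of_frame` is applied there. The umbilicity relation is needed on a whole
neighbourhood because it gets differentiated. -/
theorem inner_curvatureOp_vec₁ (hf : IsLightlikeHypersurface g f) (hU : IsOpen U)
    (F : IsotropicFrame g f U) {lam : V → ℝ} (hlam : F.IsUmbilicFactor lam) {p : V} (hp : p ∈ U)
    (X : TangentSpace (𝓡 (m + 1)) p) (hX : g.val (f p) (dmap f p X) (dmap f p X) ≠ 0) :
    g.val (f p) (F.vec₁ p) (curvatureOp g (f p) (dmap f p X) (F.vec₁ p) (dmap f p X)) =
      F.mu lam p * g.val (f p) (dmap f p X) (dmap f p X) := by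
  set ψ := extChartAt (𝓡 (m + 1)) p with hψ
  set e₀ := extChartAt (𝓡 (m + 2)) (f p) with he₀
  set Fc : Model (m + 1) → Model (m + 2) := fun y ↦ e₀ (f (ψ.symm y)) with hFc
  set c₁ : Model (m + 1) → Model (m + 1) := fun y ↦ comp p (ψ.symm y) (F.e₁ (ψ.symm y)) with hc₁
  set c : Fin m → Model (m + 1) → Model (m + 1) := fun a y ↦
    comp p (ψ.symm y) (F.e a (ψ.symm y)) with hc
  have hfd : ∀ q, MDifferentiableAt (𝓡 (m + 1)) (𝓡 (m + 2)) f q := fun q ↦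
    hf.contMDiff.contMDiffAt.mdifferentiableAt (by simp)
  have good : ∀ᶠ q in 𝓝 p, q ∈ (chartAt (Model (m + 1)) p).source ∧ q ∈ U ∧
      f q ∈ (chartAt (Model (m + 2)) (f p)).source := by
    filter_upwards [(chartAt (Model (m + 1)) p).open_source.mem_nhds (mem_chart_source _ p),
      hU.mem_nhds hp, hf.contMDiff.continuous.continuousAt.eventually
        ((chartAt (Model (m + 2)) (f p)).open_source.mem_nhds (mem_chart_source _ (f p)))]
      with q h1 h2 h3
    exact ⟨h1, h2, h3⟩
  have ev {Q : Model (m + 1) → Prop} (h : ∀ q, q ∈ (chartAt (Model (m + 1)) p).source → q ∈ U →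
      f q ∈ (chartAt (Model (m + 2)) (f p)).source → Q (ψ q)) : ∀ᶠ y in 𝓝 (ψ p), Q y :=
    eventually_chart (good.mono fun q hq ↦ h q hq.1 hq.2.1 hq.2.2)
  have linv {q} (hq : q ∈ (chartAt (Model (m + 1)) p).source) : ψ.symm (ψ q) = q :=
    ψ.left_inv (by simpa [hψ] using hq)
  have hFq {q} (hq : q ∈ (chartAt (Model (m + 1)) p).source) : Fc (ψ q) = e₀ (f q) := by
    simp only [hFc, linv hq]
  have hc₁q {q} (hq : q ∈ (chartAt (Model (m + 1)) p).source) :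
      c₁ (ψ q) = comp p q (F.e₁ q) :=
    congrArg (fun q' ↦ comp p q' (F.e₁ q')) (linv hq)
  have hcq {q} (hq : q ∈ (chartAt (Model (m + 1)) p).source) (a) :
      c a (ψ q) = comp p q (F.e a q) :=
    congrArg (fun q' ↦ comp p q' (F.e a q')) (linv hq)
  have htgt {q} (hq : q ∈ (chartAt (Model (m + 1)) p).source)
      (hfq : f q ∈ (chartAt (Model (m + 2)) (f p)).source) : Fc (ψ q) ∈ e₀.target := by
    rw [hFq hq]; exact e₀.map_source (by simpa [he₀] using hfq)
  have hD {q} (hq : q ∈ (chartAt (Model (m + 1)) p).source)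
      (hfq : f q ∈ (chartAt (Model (m + 2)) (f p)).source) (X) :
      fderiv ℝ Fc (ψ q) (comp p q X) = comp (f p) (f q) (dmap f q X) :=
    fderiv_chart_map hq hfq (hfd q) X
  have hin {q} (hq : q ∈ (chartAt (Model (m + 1)) p).source)
      (hfq : f q ∈ (chartAt (Model (m + 2)) (f p)).source) (v w) :
      metricCoord g (f p) (Fc (ψ q)) (comp (f p) (f q) v) (comp (f p) (f q) w) =
        g.val (f q) v w := by
    rw [hFq hq, inner_eq_metricCoord g hfq]
  -- At nearby `q` the covariant derivative is defined in the chart of `f q`; `comp_covDeriv` moves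
  -- it to the fixed chart of `f p`.
  have hcov {q} (hq : q ∈ (chartAt (Model (m + 1)) p).source)
      (hfq : f q ∈ (chartAt (Model (m + 2)) (f p)).source)
      {A : (q : V) → TangentSpace (𝓡 (m + 1)) q}
      (hA : ContMDiffAt (𝓡 (m + 1)) (𝓡 (m + 2)).tangent ∞
        (fun q ↦ (⟨f q, dmap f q (A q)⟩ : TangentBundle (𝓡 (m + 2)) M)) q) (X) :
      fderiv ℝ (fun y ↦ fderiv ℝ Fc y (comp p (ψ.symm y) (A (ψ.symm y)))) (ψ q) (comp p q X) +
        christoffelCLM g (f p) (Fc (ψ q)) (comp (f p) (f q) (dmap f q X))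
          (comp (f p) (f q) (dmap f q (A q))) =
        comp (f p) (f q) (covDeriv g f (fun q ↦ dmap f q (A q)) q X) := by
    rw [comp_covDeriv g hq hfq hA, hFq hq]
    congr 2
    refine Filter.EventuallyEq.fderiv_eq ?_
    filter_upwards [(isOpen_extChartAt_target p).mem_nhds
      (ψ.map_source (by simpa [hψ] using hq)), (tendsto_chart_symm hq).eventually
      ((hfd q).continuousAt.eventually
        ((chartAt (Model (m + 2)) (f p)).open_source.mem_nhds hfq))] with y hy hfy
    have h1 := hD (q := ψ.symm y) (by simpa [hψ] using ψ.map_target hy) hfy (A (ψ.symm y))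
    rwa [ψ.right_inv hy] at h1
  have hp₀ : p ∈ (chartAt (Model (m + 1)) p).source := mem_chart_source _ _
  have hfp₀ : f p ∈ (chartAt (Model (m + 2)) (f p)).source := mem_chart_source _ _
  have key := inner_curvature_of_frame (G := metricCoord g (f p)) (Γ := christoffelCLM g (f p))
    (F := Fc) (y := ψ p) (e₁ := c₁) (e := c) (lam := fun y ↦ lam (ψ.symm y))
    (N := comp (f p) (f p) (F.en p)) (u := comp p p X)
    (ev fun q hq hqU hfq ↦
      (contDiffAt_chart_map hq hfq hf.contMDiff.contMDiffAt).of_le ENat.LEInfty.out)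
    (differentiableAt_christoffelCLM g (htgt hp₀ hfp₀))
    (ev fun q hq hqU hfq ↦ (contDiffAt_metricCoord g (htgt hq hfq)).differentiableAt (by simp))
    (metricCoord_symm g (f p))
    (ev fun q hq hqU hfq ↦ metricCoord_nondegenerate g (htgt hq hfq))
    (ev fun q hq hqU hfq ↦ koszul_christoffelCLM g (htgt hq hfq))
    (ev fun q hq hqU hfq ↦
      differentiableAt_comp_field hq (F.smooth_e₁.contMDiffAt (hU.mem_nhds hqU)))
    (ev fun q hq hqU hfq a ↦
      differentiableAt_comp_field hq ((F.smooth_e a).contMDiffAt (hU.mem_nhds hqU)))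
    (ev fun q hq hqU hfq ↦ by
      intro w _
      have h1 : comp p q (uncomp p q w) ∈ (Submodule.span ℝ (insert (F.e₁ q)
          (Set.range fun a ↦ F.e a q))).map (comp p q).toLinearMap :=
        Submodule.mem_map_of_mem (by rw [F.span_eq_top hqU]; trivial)
      rw [comp_uncomp hq, Submodule.map_span, Set.image_insert_eq, ← Set.range_comp] at h1
      rw [hc₁q hq]
      simp only [hcq hq]
      exact h1)
    (ev fun q hq hqU hfq ↦ by
      rw [hc₁q hq, hD hq hfq, hin hq hfq, F.g_e₁_e₁ q hqU])
    (ev fun q hq hqU hfq a ↦ by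
      rw [hc₁q hq, hcq hq, hD hq hfq, hD hq hfq, hin hq hfq, F.g_e₁_e q hqU])
    (ev fun q hq hqU hfq a b ↦ by
      rw [hc₁q hq, hcq hq, hcq hq, hD hq hfq, hD hq hfq, hD hq hfq, hin hq hfq,
        hcov hq hfq (F.contMDiffAt_vec hU hf.contMDiff a hqU), hin hq hfq, linv hq]
      have h1 := hlam q hqU a b
      simp only [IsotropicFrame.secondFundamental, IsotropicFrame.omegaN] at h1
      have h2 : g.val (f q) (covDeriv g f (fun q ↦ dmap f q (F.e a q)) q (F.e b q))
          (dmap f q (F.e₁ q)) = -(lam q * F.metric a b q) := by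
        rw [← h1, neg_neg]; rfl
      rw [h2, neg_mul]
      rfl)
    (by rw [hc₁q hp₀, hD hp₀ hfp₀, hin hp₀ hfp₀, F.g_e₁_en p hp])
    (fun W hW hWX ↦ by
      rw [← comp_uncomp hfp₀ W] at hW hWX ⊢
      rw [hin hp₀ hfp₀] at hW
      rw [F.eq_zero_of_inner hf hp hW fun X' ↦ ?_, map_zero]
      have := hWX (comp p p X')
      rwa [hD hp₀ hfp₀, hin hp₀ hfp₀] at this)
    (by rwa [hD hp₀ hfp₀, hin hp₀ hfp₀])
  obtain ⟨hdiff, key⟩ := key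
  rw [hc₁q hp₀, hD hp₀ hfp₀, hD hp₀ hfp₀, hin hp₀ hfp₀,
    hcov hp₀ hfp₀ (F.contMDiffAt_vec₁ hU hf.contMDiff hp), hin hp₀ hfp₀, linv hp₀,
    ← mvfderiv_eq_fderiv_chart hp₀ (mdifferentiableAt_of_comp_chart hp₀ hdiff)] at key
  have hR : comp (f p) (f p) (curvatureOp g (f p) (dmap f p X) (F.vec₁ p) (dmap f p X)) =
      coordCurvature (christoffelCLM g (f p)) (Fc (ψ p)) (comp (f p) (f p) (dmap f p X))
        (comp (f p) (f p) (F.vec₁ p)) (comp (f p) (f p) (dmap f p X)) := by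
    rw [comp_self, comp_self, comp_self, hFq hp₀]
    exact curvatureOp_eq g (f p) _ _ _
  rw [← hin hp₀ hfp₀ (F.vec₁ p), hR]
  refine key.trans ?_
  rw [IsotropicFrame.mu, IsotropicFrame.omega₁₁, mul_neg, sub_neg_eq_add]
  rfl

/-- The isotropic sectional curvature in the direction of `e₁` is `μ / 2`. -/
theorem isIsotropicSectionalCurvature_vec₁ (hf : IsLightlikeHypersurface g f) (hU : IsOpen U)
    (F : IsotropicFrame g f U) {lam : V → ℝ} (hlam : F.IsUmbilicFactor lam) {p : V} (hp : p ∈ U)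
    {σ : Submodule ℝ (TangentSpace (𝓡 (m + 2)) (f p))} (hσ : Module.finrank ℝ σ = 2)
    (hle : σ ≤ tangentHyperplane f p) :
    IsIsotropicSectionalCurvature g (f p) (F.vec₁ p) σ (F.mu lam p / 2) := by
  refine ⟨F.exists_inner_ne_zero hp hσ hle, fun P hP hPP ↦ ?_⟩
  obtain ⟨X, rfl⟩ := hle hP
  rw [eq_div_iff hPP, curvatureTensor]
  have := inner_curvatureOp_vec₁ hf hU F hlam hp X hPP
  change _ = 1 / 2 * g.val (f p) (F.vec₁ p) (curvatureOp g (f p) (dmap f p X) (F.vec₁ p)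
    (dmap f p X))
  rw [this]
  change F.mu lam p / 2 * g.val (f p) (dmap f p X) (dmap f p X) = _
  ring

/-- The numerator is quadratic in `N` and the denominator does not involve it. -/
theorem IsIsotropicSectionalCurvature.smul {x : M} {N : TangentSpace (𝓡 (m + 2)) x}
    {σ : Submodule ℝ (TangentSpace (𝓡 (m + 2)) x)} {k : ℝ}
    (h : IsIsotropicSectionalCurvature g x N σ k) (c : ℝ) :
    IsIsotropicSectionalCurvature g x (c • N) σ (c ^ 2 * k) := by
  refine ⟨h.1, fun P hP hPP ↦ ?_⟩
  have h1 : ∀ u v w : Model (m + 2), curvatureOp g x u (c • v) w = c • curvatureOp g x u v w := by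
    intro u v w
    rw [curvatureOp_eq, curvatureOp_eq, coordCurvature_smul]
    rfl
  rw [h.2 P hP hPP, curvatureTensor, curvatureTensor]
  rw [show curvatureOp g x P (c • N) P = c • curvatureOp g x P N P from h1 P N P]
  simp only [map_smul, smul_apply, smul_eq_mul]
  ring

end Main
end Lightlike

theorem theorem9 {m : ℕ} {M : Type*} [TopologicalSpace M]
    [ChartedSpace (Lightlike.Model (m + 2)) M] [IsManifold (𝓡 (m + 2)) ∞ M]
    {V : Type*} [TopologicalSpace V]
    [ChartedSpace (Lightlike.Model (m + 1)) V] [IsManifold (𝓡 (m + 1)) ∞ V]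
    (g : Lightlike.LorentzMetric m M) (f : V → M)
    (hf : Lightlike.IsLightlikeHypersurface g f)
    (hu : Lightlike.IsTotallyUmbilical g f) :
    (∀ (p : V) (N : TangentSpace (𝓡 (m + 2)) (f p)),
      N ∈ Lightlike.tangentHyperplane f p → N ≠ 0 → g.val (f p) N N = 0 →
      ∃ k : ℝ, ∀ σ : Submodule ℝ (TangentSpace (𝓡 (m + 2)) (f p)),
        Module.finrank ℝ σ = 2 → σ ≤ Lightlike.tangentHyperplane f p → N ∈ σ →
        Lightlike.IsIsotropicSectionalCurvature g (f p) N σ k) ∧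
    (∀ (U : Set V), IsOpen U → ∀ (F : Lightlike.IsotropicFrame g f U) (lam : V → ℝ),
      F.IsUmbilicFactor lam → ∀ p ∈ U,
        ∀ σ : Submodule ℝ (TangentSpace (𝓡 (m + 2)) (f p)),
          Module.finrank ℝ σ = 2 → σ ≤ Lightlike.tangentHyperplane f p → F.vec₁ p ∈ σ →
          Lightlike.IsIsotropicSectionalCurvature g (f p) (F.vec₁ p) σ (F.mu lam p / 2)) := by
  refine ⟨fun p N hN _ hNN ↦ ?_, fun U hU F lam hlam p hp σ hσ hle _ ↦
    Lightlike.isIsotropicSectionalCurvature_vec₁ hf hU F hlam hp hσ hle⟩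
  obtain ⟨U, hU, hp, F, lam, hlam, -⟩ := hu p
  -- Isotropic tangent vectors are multiples of `e₁`, so `c² μ/2` is a value common to all planes
  -- through `N`.
  obtain ⟨c, rfl⟩ := F.eq_smul_vec₁ hp hN hNN
  exact ⟨c ^ 2 * (F.mu lam p / 2), fun σ hσ hle _ ↦
    (Lightlike.isIsotropicSectionalCurvature_vec₁ hf hU F hlam hp hσ hle).smul c⟩
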